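/- **Conventions.** For a simplicial complex $X$ (simplices are finite, and the empty simplex has dimension $-1$), let $C_j(X)$, $j\ge -1$, be the group of integral oriented simplicial $j$-chains, i.e. finite formal sums $\sum_\sigma t_\sigma\sigma$ over oriented $j$-simplices with $t_\sigma\in\mathbb Z$ and $t_{-\sigma}=-t_\sigma$; let $\mathbb 1_\sigma$ be the elementary chain of $\sigma$ (coefficient $1$ on $\sigma$, $-1$ on $-\sigma$, $0$ elsewhere), let $\partial_j:C_j(X)\to C_{j-1}(X)$ be the (augmented) boundary map $\partial_j\mathbb 1_{[v_0,\dots,v_j]}=\sum_i(-1)^i\mathbb 1_{[v_0,\dots,\hat v_i,\dots,v_j]}$, and let $\operatorname{supp}(A)$ be the set of unoriented simplices on which $A$ has a nonzero coefficient. For $k\ge-1$, a *$k$-cone function* on $X$ with apex a vertex $v$ of $X$ is a family of homomorphisms $\operatorname{Cone}_X:C_j(X)\to C_{j+1}(X)$, $-1\le j\le k$, with $\operatorname{Cone}_X(a\mathbb 1_\emptyset)=a\mathbb 1_{[v]}$ for $a\in\mathbb Z$ and $$\partial_{j+1}\operatorname{Cone}_X(A)+\operatorname{Cone}_X(\partial_jA)=A\qquad(0\le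 j\le k,\ A\in C_j(X)).$$ Its $j$-th radius is $\operatorname{Rad}_j(\operatorname{Cone}_X)=\sup_{\sigma,a}|\operatorname{supp}(\operatorname{Cone}_X(a\mathbb 1_\sigma))|$, over oriented $j$-simplices $\sigma$ and $a\in\mathbb Z$. Let $K$ be a field or skew field and $V$ a finite-dimensional $K$-vector space. Two subspaces $U,W$ of $V$ are *transversal* if $U\cap W=0$ or $U+W=V$. For a set $\mathcal E$ of subspaces of $V$, $T_{\mathcal E}(V)$ is the flag complex (finite sets of pairwise comparable subspaces) on the subspaces $0<U<V$ that are transversal to every $E\in\mathcal E$. The class $\mathbf C_A$ consists, in dimension $n\ge0$, of the complexes $T_{\mathcal E}(V)$ with $\dim V=n+2$, $\mathcal E$ finite, and $$\sum_{j=1}^{n+1}\binom{n}{j-1}e_j\le|K|,\qquad e_j=|\{E\in\mathcal E:\dim E=j\}|.$$ For $n\ge 1$, the building $\Delta$ of type $A_n$ over $K$ is the flag complex of all subspaces $0<U<V$, where $\dim V=n+1$. Its chambers are the complete flags. Two chambers are *opposite* if there is a basis $b_0,\dots,b_n$ of $V$ such that one of them is the flag $\langle b_0\rangle<\langle b_0,b_1\rangle<\dots<\langle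 b_0,\dots,b_{n-1}\rangle$ and the other one is the flag obtained in the same way from the reversed basis $b_n,\dots,b_0$ (equivalently, if they correspond to cosets $gB,hB$ of the flag stabilizer $B$ in $GL(V)$ with $g^{-1}h\in Bw_0B$, where $w_0$ is the longest element of the Weyl group). For a simplex $a\in\Delta$, the opposition complex is $$\Delta^0(a)=\{\tau\in\Delta:\text{there are opposite chambers }c\supseteq\tau,\ d\supseteq a\}.$$ **Corollary.** There are constants $\mathcal R(n)$, $n\in\mathbb N\cup\{0\}$, depending only on $n$, such that the following holds. 1. For every $n\ge0$, every complex $T_{\mathcal E}(V)$ in the class $\mathbf C_A$ of dimension $n$ (over any field or skew field $K$) has an $(n-1)$-cone function with $$\operatorname{Rad}_k(\operatorname{Cone}_{T_{\mathcal E}(V)})\le\mathcal R(n)\qquad\text{for all }-1\le k\le n-1.$$ 2. In particular, for every $n\ge1$, if $\Delta$ is a building of type $A_n$ over a field or skew field $K$ with $|K|\ge2^{n-1}$ and $a\in\Delta$ is a simplex, then $\Delta^0(a)$ has an $(n-2)$-cone function with $$\operatorname{Rad}_j(\operatorname{Cone}_{\Delta^0(a)})\le\mathcal R(n-1)\qquad\text{for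 all }-1\le j\le n-2.$$ -/

import Mathlib

universe u v

/-! ### Simplicial complexes and chains

`PreAbstractSimplicialComplex ι` is Mathlib's notion of an abstract simplicial complex with vertices
in `ι`; its faces are nonempty finite sets.  The empty simplex, of dimension `-1`, is added in
`simplices`.  Degrees are counted by the number of vertices: degree `p` means dimension `p - 1`. -/

namespace ConeRadius

section Chains

variable {ι : Type*}

/-- All simplices of `X`, including the empty one. -/
def simplices (X : PreAbstractSimplicialComplex ι) : Set (Finset ι) := insert ∅ X.faces

/-- The tuple `v` lists, without repetition, the vertices of a simplex of `X`. -/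
def IsOrdered (X : PreAbstractSimplicialComplex ι) {p : ℕ} (v : Fin p → ι) : Prop :=
  ∃ hv : Function.Injective v, Finset.univ.map ⟨v, hv⟩ ∈ simplices X

/-- Ordered simplices of `X` with `p` vertices (dimension `p - 1`).  An ordered simplex
`(v₀, …, v_{p-1})` represents the oriented simplex `[v₀, …, v_{p-1}]`. -/
def OrderedSimplex (X : PreAbstractSimplicialComplex ι) (p : ℕ) : Type _ :=
  {v : Fin p → ι // IsOrdered X v}

theorem IsOrdered.comp {X : PreAbstractSimplicialComplex ι} {p q : ℕ} {v : Fin p → ι}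
    (hv : IsOrdered X v) (g : Fin q → Fin p) (hg : Function.Injective g) :
    IsOrdered X (v ∘ g) := by
  obtain ⟨hi, hX⟩ := hv
  refine ⟨hi.comp hg, ?_⟩
  rcases Nat.eq_zero_or_pos q with rfl | hq
  · left
    simp
  · right
    have hne : (Finset.univ.map ⟨v ∘ g, hi.comp hg⟩).Nonempty :=
      ⟨(v ∘ g) ⟨0, hq⟩, by simp⟩
    have hsub : Finset.univ.map ⟨v ∘ g, hi.comp hg⟩ ⊆ Finset.univ.map ⟨v, hi⟩ := by
      intro x hx
      simp only [Finset.mem_map, Finset.mem_univ, true_and, Function.Embedding.coeFn_mk,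
        Function.comp_apply] at hx ⊢
      obtain ⟨y, rfl⟩ := hx
      exact ⟨g y, rfl⟩
    rcases hX with h0 | h
    · rw [h0, Finset.subset_empty] at hsub
      exact absurd hsub hne.ne_empty
    · exact (X.isRelLowerSet_faces h).2 hsub hne

/-- The integral chains of dimension `p - 1`: finite formal sums `∑ t_σ σ` over oriented simplices
with `t_{-σ} = -t_σ`, i.e. finitely supported integer functions on ordered simplices that change by
the sign of the permutation when the vertices are permuted. -/
def chains (X : PreAbstractSimplicialComplex ι) (p : ℕ) : Submodule ℤ ((Fin p → ι) →₀ ℤ) where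
  carrier := {t | (∀ v, t v ≠ 0 → IsOrdered X v) ∧
    ∀ (γ : Equiv.Perm (Fin p)) (v : Fin p → ι), t (v ∘ γ) = (Equiv.Perm.sign γ : ℤ) * t v}
  zero_mem' := by simp
  add_mem' := by
    rintro s t ⟨hs, hs'⟩ ⟨ht, ht'⟩
    refine ⟨fun v hv => ?_, fun γ v => ?_⟩
    · by_cases h : s v = 0
      · exact ht v (by simpa [h] using hv)
      · exact hs v h
    · simp only [Finsupp.add_apply, hs', ht', mul_add]
  smul_mem' := by
    rintro a t ⟨ht, ht'⟩
    refine ⟨fun v hv => ht v fun h => hv (by simp [h]), fun γ v => ?_⟩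
    simp only [Finsupp.smul_apply, ht', smul_eq_mul]
    ring

/-- The elementary chain `𝟙_σ` of the oriented simplex `σ = [v₀, …, v_{p-1}]`: coefficient `1` on
`σ`, `-1` on `-σ`, and `0` on all other oriented simplices. -/
noncomputable def elementary {X : PreAbstractSimplicialComplex ι} {p : ℕ}
    (σ : OrderedSimplex X p) : chains X p :=
  ⟨∑ γ : Equiv.Perm (Fin p), Finsupp.single (σ.1 ∘ γ) (Equiv.Perm.sign γ : ℤ), by
    classical
    constructor
    · intro v hv
      rw [Finsupp.finsetSum_apply] at hv
      obtain ⟨γ, -, hγ⟩ := Finset.exists_ne_zero_of_sum_ne_zero hv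
      have h : σ.1 ∘ γ = v := by
        by_contra h
        exact hγ (by simp [h])
      exact h ▸ σ.2.comp γ γ.injective
    · intro δ v
      rw [Finsupp.finsetSum_apply, Finsupp.finsetSum_apply, Finset.mul_sum]
      refine Fintype.sum_equiv (Equiv.mulRight δ⁻¹) _ _ fun γ => ?_
      have hc : (σ.1 ∘ γ = v ∘ δ) ↔ (σ.1 ∘ ⇑(γ * δ⁻¹) = v) := by
        constructor
        · intro h
          funext x
          simpa using congrFun h (δ⁻¹ x)
        · intro h
          funext x
          simpa using congrFun h (δ x)
      have hs : (Equiv.Perm.sign δ : ℤ) * (Equiv.Perm.sign δ : ℤ) = 1 := by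
        rw [← Units.val_mul, Int.units_mul_self, Units.val_one]
      simp only [Finsupp.single_apply, hc, Equiv.coe_mulRight]
      split_ifs
      · rw [map_mul, Equiv.Perm.sign_inv, Units.val_mul, mul_left_comm, hs, mul_one]
      · simp⟩

theorem boundary_mem {X : PreAbstractSimplicialComplex ι} {p : ℕ}
    {t : (Fin (p + 1) → ι) →₀ ℤ} (ht : t ∈ chains X (p + 1)) :
    Finsupp.mapDomain (fun v : Fin (p + 1) → ι => v ∘ Fin.succ) t ∈ chains X p := by
  classical
  obtain ⟨h1, h2⟩ := ht
  constructor
  · intro w hw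
    have hw' := Finsupp.mapDomain_support (Finsupp.mem_support_iff.mpr hw)
    obtain ⟨v, hv, rfl⟩ := Finset.mem_image.mp hw'
    exact (h1 v (Finsupp.mem_support_iff.mp hv)).comp _ (Fin.succ_injective _)
  · intro γ w
    let γ' : Equiv.Perm (Fin (p + 1)) := Equiv.Perm.decomposeFin.symm (0, γ)
    have hγ : ∀ i, γ' i.succ = (γ i).succ := fun i => by
      simp [γ', Equiv.Perm.decomposeFin_symm_apply_succ]
    have hsign : Equiv.Perm.sign γ' = Equiv.Perm.sign γ := by
      simp [γ', Equiv.Perm.decomposeFin.symm_sign]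
    have key : ∀ {q : ℕ} (δ : Equiv.Perm (Fin q)) (s : (Fin q → ι) →₀ ℤ) (u : Fin q → ι),
        Finsupp.mapDomain (fun v : Fin q → ι => v ∘ ⇑δ.symm) s u = s (u ∘ δ) := by
      intro q δ s u
      have hinj : Function.Injective (fun v : Fin q → ι => v ∘ ⇑δ.symm) := by
        intro a b hab
        funext x
        simpa using congrFun hab (δ x)
      have h := Finsupp.mapDomain_apply hinj s (u ∘ δ)
      have hu : (u ∘ δ) ∘ ⇑δ.symm = u := by
        funext x
        simp
      simpa only [hu] using h
    have hγs : ∀ i, γ'.symm i.succ = (γ.symm i).succ := fun i => by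
      rw [Equiv.symm_apply_eq, hγ]
      simp
    have ht' : Finsupp.mapDomain (fun v : Fin (p + 1) → ι => v ∘ ⇑γ'.symm) t =
        (Equiv.Perm.sign γ : ℤ) • t := by
      ext u
      rw [key, h2, hsign]
      simp
    rw [← key γ, ← Finsupp.mapDomain_comp]
    have hcomp : ((fun v : Fin p → ι => v ∘ ⇑γ.symm) ∘
        fun v : Fin (p + 1) → ι => v ∘ Fin.succ) =
        (fun v : Fin (p + 1) → ι => v ∘ Fin.succ) ∘
          fun v : Fin (p + 1) → ι => v ∘ ⇑γ'.symm := by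
      funext v i
      simp [hγs]
    rw [hcomp, Finsupp.mapDomain_comp, ht', Finsupp.mapDomain_smul]
    simp

/-- The boundary map.  In terms of coefficients,
`(∂ t)_{[v₁, …, v_p]} = ∑ v, t_{[v, v₁, …, v_p]}`; that this is the usual
`∂ [v₀, …, v_p] = ∑ i, (-1)^i [v₀, …, v̂ᵢ, …, v_p]` is `boundary_elementary` below. -/
noncomputable def boundary (X : PreAbstractSimplicialComplex ι) (p : ℕ) :
    chains X (p + 1) →ₗ[ℤ] chains X p :=
  ((Finsupp.lmapDomain ℤ ℤ fun v : Fin (p + 1) → ι => v ∘ Fin.succ).comp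
    (chains X (p + 1)).subtype).codRestrict (chains X p) fun t => boundary_mem t.2

/-- The ordered simplex with the `i`-th vertex removed. -/
def OrderedSimplex.face {X : PreAbstractSimplicialComplex ι} {p : ℕ}
    (σ : OrderedSimplex X (p + 1)) (i : Fin (p + 1)) : OrderedSimplex X p :=
  ⟨σ.1 ∘ i.succAbove, σ.2.comp _ Fin.succAbove_right_injective⟩

theorem boundary_elementary {X : PreAbstractSimplicialComplex ι} {p : ℕ}
    (σ : OrderedSimplex X (p + 1)) :
    boundary X p (elementary σ) = ∑ i : Fin (p + 1), (-1 : ℤ) ^ (i : ℕ) • elementary (σ.face i) := by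
  classical
  let e : Fin (p + 1) × Equiv.Perm (Fin p) → Equiv.Perm (Fin (p + 1)) := fun x =>
    x.1.cycleRange⁻¹ * Equiv.Perm.decomposeFin.symm (0, x.2)
  have he0 : ∀ x, e x 0 = x.1 := fun x => by
    simp [e, Equiv.Perm.inv_def, Fin.cycleRange_symm_zero]
  have hes : ∀ x j, e x (Fin.succ j) = x.1.succAbove (x.2 j) := fun x j => by
    simp [e, Equiv.Perm.inv_def, Fin.cycleRange_symm_succ]
  have hbij : Function.Bijective e := by
    rw [Fintype.bijective_iff_injective_and_card]
    refine ⟨fun x y hxy => ?_, ?_⟩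
    · have h1 : x.1 = y.1 := by rw [← he0 x, ← he0 y, hxy]
      have h2 : x.2 = y.2 := by
        ext j
        have h := hes x j
        rw [hxy, hes y j, h1] at h
        exact congrArg Fin.val (Fin.succAbove_right_injective h).symm
      exact Prod.ext h1 h2
    · simp [Fintype.card_perm, Nat.factorial_succ]
  apply Subtype.ext
  have hL : (boundary X p (elementary σ) : (Fin p → ι) →₀ ℤ) =
      ∑ γ : Equiv.Perm (Fin (p + 1)),
        Finsupp.single (σ.1 ∘ γ ∘ Fin.succ) (Equiv.Perm.sign γ : ℤ) := by
    change Finsupp.lmapDomain ℤ ℤ (fun v : Fin (p + 1) → ι => v ∘ Fin.succ)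
      (∑ γ : Equiv.Perm (Fin (p + 1)), Finsupp.single (σ.1 ∘ γ) (Equiv.Perm.sign γ : ℤ)) = _
    simp only [map_sum, Finsupp.lmapDomain_apply, Finsupp.mapDomain_single, Function.comp_assoc]
  rw [hL, ← (Equiv.ofBijective e hbij).sum_comp, Fintype.sum_prod_type,
    AddSubmonoidClass.coe_finsetSum]
  refine Finset.sum_congr rfl fun i _ => ?_
  rw [Submodule.coe_smul]
  simp only [elementary, Finset.smul_sum, Finsupp.smul_single, smul_eq_mul]
  refine Finset.sum_congr rfl fun δ _ => ?_
  have h1 : σ.1 ∘ ⇑(Equiv.ofBijective e hbij (i, δ)) ∘ Fin.succ = (σ.face i).1 ∘ δ := by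
    funext j
    simp [hes, OrderedSimplex.face]
  have h2 : ((Equiv.Perm.sign (Equiv.ofBijective e hbij (i, δ)) : ℤˣ) : ℤ) =
      (-1) ^ (i : ℕ) * (Equiv.Perm.sign δ : ℤ) := by
    simp [e, Fin.sign_cycleRange, Equiv.Perm.decomposeFin.symm_sign]
  rw [h1, h2]

open Classical in
/-- The support of a chain, as a set of unoriented simplices. -/
noncomputable def supp {X : PreAbstractSimplicialComplex ι} {p : ℕ} (t : chains X p) :
    Finset (Finset ι) :=
  (t : (Fin p → ι) →₀ ℤ).support.image fun v => Finset.univ.image v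

/-- The unique ordered simplex with no vertices. -/
def emptySimplex (X : PreAbstractSimplicialComplex ι) : OrderedSimplex X 0 :=
  ⟨Fin.elim0, fun i => i.elim0, Or.inl (by simp)⟩

/-- The ordered simplex `[v]` of a vertex `v`. -/
def vertexSimplex (X : PreAbstractSimplicialComplex ι) (v : ι) (hv : {v} ∈ X.faces) :
    OrderedSimplex X 1 :=
  ⟨fun _ => v, fun _ _ _ => Subsingleton.elim _ _, Or.inr (by
    convert hv using 1
    ext x
    simp only [Finset.mem_map, Finset.mem_univ, true_and, Finset.mem_singleton]
    exact ⟨fun ⟨_, h⟩ => h.symm, fun h => ⟨0, h.symm⟩⟩)⟩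

/-- An `(m - 1)`-cone function on `X` (with integer coefficients): homomorphisms
`Cone : C_{p-1}(X) → C_p(X)` for all dimensions `-1 ≤ p - 1 ≤ m - 1`, sending `a 𝟙_∅` to
`a 𝟙_[apex]` and satisfying the cone equation `∂ Cone(A) + Cone(∂ A) = A` in the dimensions
`0, …, m - 1`. -/
structure ConeFunction (X : PreAbstractSimplicialComplex ι) (m : ℕ) where
  /-- the apex, a vertex of `X` -/
  apex : ι
  apex_mem : {apex} ∈ X.faces
  /-- the cone function on chains of dimension `p - 1` -/
  toFun : ∀ p : ℕ, p ≤ m → (chains X p →ₗ[ℤ] chains X (p + 1))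
  map_empty : ∀ a : ℤ,
    toFun 0 (Nat.zero_le m) (a • elementary (emptySimplex X)) =
      a • elementary (vertexSimplex X apex apex_mem)
  cone_equation : ∀ (p : ℕ) (hp : p + 1 ≤ m) (A : chains X (p + 1)),
    boundary X (p + 1) (toFun (p + 1) hp A) +
      toFun p (Nat.le_of_succ_le hp) (boundary X p A) = A

/-- The radius of a cone function in dimension `p - 1`, i.e. `Rad_{p-1}`: the supremum of
`|supp (Cone (a 𝟙_σ))|` over oriented simplices `σ` of dimension `p - 1` and integers `a`. -/
noncomputable def ConeFunction.radius {X : PreAbstractSimplicialComplex ι} {m : ℕ}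
    (C : ConeFunction X m) (p : ℕ) (hp : p ≤ m) : ℕ∞ :=
  ⨆ (σ : OrderedSimplex X p) (a : ℤ), ((supp (C.toFun p hp (a • elementary σ))).card : ℕ∞)

end Chains

/-! ### Buildings of type `A` and their subcomplexes -/

/-- The flag complex of a set `S` with an incidence relation `r`: the finite nonempty subsets of `S`
whose elements are pairwise incident. -/
def flagComplex {α : Type*} (S : Set α) (r : α → α → Prop) : PreAbstractSimplicialComplex α where
  faces := {s | s.Nonempty ∧ (∀ a ∈ s, a ∈ S) ∧ ∀ a ∈ s, ∀ b ∈ s, r a b}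
  isRelLowerSet_faces := by
    rintro s ⟨h0, h1, h2⟩
    exact ⟨h0, fun t hts ht => ⟨ht, fun a ha => h1 a (hts ha),
      fun a ha b hb => h2 a (hts ha) b (hts hb)⟩⟩

section Building

variable {K V : Type*} [DivisionRing K] [AddCommGroup V] [Module K V]

/-- Incidence of subspaces: one contains the other. -/
def Incident (U W : Submodule K V) : Prop := U ≤ W ∨ W ≤ U

variable (K V) in
/-- The building of `V`: the flag complex of the proper nonzero subspaces.  If `dim V = n + 1`, it is
the building of type `Aₙ` over `K`. -/
def building : PreAbstractSimplicialComplex (Submodule K V) :=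
  flagComplex {U | U ≠ ⊥ ∧ U ≠ ⊤} Incident

/-- `U` and `W` are transversal in `V`. -/
def Transversal (U W : Submodule K V) : Prop := U ⊓ W = ⊥ ∨ U ⊔ W = ⊤

/-- The complex `T_E(V)`: the flag complex of the proper nonzero subspaces of `V` that are
transversal to every member of `E`. -/
def transversalComplex (E : Set (Submodule K V)) : PreAbstractSimplicialComplex (Submodule K V) :=
  flagComplex {U | (U ≠ ⊥ ∧ U ≠ ⊤) ∧ ∀ W ∈ E, Transversal U W} Incident

/-- The data `(K, V, E)` define a complex `T_E(V)` of dimension `n` in the class `C_A`: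
`dim V = n + 2`, `E` is finite, and `∑_{j=1}^{n+1} (n choose j-1) e_j ≤ |K|`, where `e_j` is the
number of members of `E` of dimension `j`. -/
structure InClassA (n : ℕ) (E : Set (Submodule K V)) : Prop where
  finrank_eq : Module.finrank K V = n + 2
  finite : E.Finite
  sum_le : ((∑ j ∈ Finset.Icc 1 (n + 1),
    n.choose (j - 1) * {W ∈ E | Module.finrank K W = j}.ncard : ℕ) : ℕ∞) ≤ ENat.card K

open Classical in
/-- The complete flag `⟨b₀⟩ < ⟨b₀, b₁⟩ < … < ⟨b₀, …, b_{N-2}⟩` of a basis `b₀, …, b_{N-1}`.  These are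
the chambers of the building of `V`. -/
noncomputable def flagOfBasis {N : ℕ} (b : Module.Basis (Fin N) K V) : Finset (Submodule K V) :=
  (Finset.Ioo 0 N).image fun i => Submodule.span K (b '' {j | (j : ℕ) < i})

/-- Opposite chambers.  Identify the chambers with the cosets `gB`, where `G = GL(V)` and `B` is the
stabilizer of the flag of a fixed basis.  Then `gB` and `hB` are opposite, i.e. `g⁻¹h ∈ B w₀ B`, if
and only if `gB = xB` and `hB = x w₀ B` for some `x ∈ G`, where the longest element `w₀` of the Weyl
group reverses the order of the basis: the two chambers are the flags of some basis (the image of the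
fixed one under `x`) and of the same basis in reversed order. -/
def Opposite (c d : Finset (Submodule K V)) : Prop :=
  ∃ b : Module.Basis (Fin (Module.finrank K V)) K V,
    c = flagOfBasis b ∧ d = flagOfBasis (b.reindex Fin.revPerm)

/-- The complex `Δ⁰(σ)` opposite a simplex `σ` of the building `Δ` of `V`: the simplices `τ` of `Δ`
such that there are opposite chambers `c ⊇ τ` and `d ⊇ σ`. -/
def oppositionComplex (σ : Finset (Submodule K V)) :
    PreAbstractSimplicialComplex (Submodule K V) where
  faces := {τ | τ ∈ (building K V).faces ∧ ∃ c d, Opposite c d ∧ τ ⊆ c ∧ σ ⊆ d}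
  isRelLowerSet_faces := by
    rintro s ⟨hs, c, d, hcd, hsc, hd⟩
    obtain ⟨hne, hlow⟩ := (building K V).isRelLowerSet_faces hs
    exact ⟨hne, fun t hts ht => ⟨hlow hts ht, c, d, hcd, hts.trans hsc, hd⟩⟩

end Building

end ConeRadius

/-!
The complexes `T_E(V)` are contracted by induction on the dimension of `V`. The weight bound
leaves a line `l` contained in no proper member of `E`, because `V` is not a union of at most
`|K|` proper subspaces (`exists_line_avoiding`). The vertices containing `l` span a cone with apex
`l`. Next come the vertices `U` for which `U + l` is again a vertex, attached in increasing
dimension: the link of `U` in what has been built so far is a cone with apex `U + l`. All other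
vertices follow in decreasing dimension. The link of such a `U` is the join of a complex on the
subspaces of `U` and one on the subspaces of `V / U`. Both are again of the form `T_E`, the first
for the family of all `E ∩ U` and `(E + l) ∩ U`, the second for all `(E + U) / U`; Pascal's rule
gives the weight bound for them, so induction applies (`hasCone_transversalInterval_of_lt`).

Each step is made explicit on chains, with control on the radii. A join has a cone function built
from those of its factors (`HasCone.join`). If `c` is a cone function of a complex and `k` one of
the link of a new vertex `U`, then `[U, x] ↦ c (k x) - [U, k x]` extends `c` over the star of `U`
(`HasCone.attach`). The number of steps and the radii of the links depend only on the dimension,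
and hence so does the resulting bound `intervalBound`.

Flags are ordered by inclusion, so the oriented chains of a flag complex have the increasing lists
as a basis. The constructions are carried out on formal combinations of such lists, where the join
is concatenation, and are transferred at the end (`HasCone.exists_coneFunction`). Subspaces and
quotients of `V` are replaced by intervals `[A, B]` of its lattice of subspaces.

For the opposition complexes, two pairwise transversal flags are initial and final segments of a
common ordered basis (`exists_basis_of_transversal`). Therefore the complex opposite a simplex `a`
is `T_a(V)`, and `a`, having at most one member in each dimension, has weight at most
`2 ^ (n - 1)`.
-/

/-! ### Chains on lists -/

namespace ConeRadius

section FlagChains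

variable {α : Type*}

/-- The formal integral combinations of lists; the flags of a poset, listed increasingly, span the
oriented chains of its flag complex. -/
abbrev ListChain (α : Type*) := List α →₀ ℤ

namespace ListChain

/-- Linear maps on list chains that agree on a set of lists agree on the chains supported there. -/
theorem eq_of_mem_supported {M : Type*} [AddCommGroup M] {s : Set (List α)}
    {f g : ListChain α →ₗ[ℤ] M} (h : ∀ l ∈ s, f (.single l 1) = g (.single l 1))
    {x : ListChain α} (hx : x ∈ Finsupp.supported ℤ ℤ s) : f x = g x := by
  rw [Finsupp.supported_eq_span_single] at hx
  exact LinearMap.eqOn_span (s := (fun i ↦ Finsupp.single i (1 : ℤ)) '' s)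
    (by rintro _ ⟨l, hl, rfl⟩; exact h l hl) hx

theorem map_mem_of_mem_supported {M : Type*} [AddCommGroup M] {s : Set (List α)}
    {f : ListChain α →ₗ[ℤ] M} {N : Submodule ℤ M} (h : ∀ l ∈ s, f (.single l 1) ∈ N)
    {x : ListChain α} (hx : x ∈ Finsupp.supported ℤ ℤ s) : f x ∈ N := by
  rw [Finsupp.supported_eq_span_single] at hx
  have : Submodule.span ℤ ((fun i ↦ Finsupp.single i (1 : ℤ)) '' s) ≤ N.comap f :=
    Submodule.span_le.2 (by rintro _ ⟨l, hl, rfl⟩; exact h l hl)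
  exact this hx

theorem mem_supported_of_forall {s t : Set (List α)} {x : ListChain α}
    (hx : x ∈ Finsupp.supported ℤ ℤ s) (h : ∀ l ∈ s, l ∈ t) : x ∈ Finsupp.supported ℤ ℤ t :=
  Finsupp.supported_mono h hx

theorem hom_ext {M : Type*} [AddCommGroup M] {f g : ListChain α →ₗ[ℤ] M}
    (h : ∀ l, f (.single l 1) = g (.single l 1)) : f = g :=
  LinearMap.ext fun x => eq_of_mem_supported (s := Set.univ) (fun l _ => h l)
    (by simp)

/-- The linear map with prescribed values on lists. -/
noncomputable def extend (f : List α → ListChain α) : ListChain α →ₗ[ℤ] ListChain α :=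
  Finsupp.linearCombination ℤ f

@[simp] theorem extend_single (f : List α → ListChain α) (l : List α) :
    extend f (.single l 1) = f l := by
  simp [extend]

/-- Prepend a vertex to every list. -/
noncomputable def cons (x : α) : ListChain α →ₗ[ℤ] ListChain α :=
  Finsupp.lmapDomain ℤ ℤ (List.cons x)

@[simp] theorem cons_single (x : α) (l : List α) :
    cons x (.single l 1) = .single (x :: l) 1 := by
  simp [cons]

/-- The boundary of a list, as the iterated relation `∂ (x l) = l - x ∂ l`. -/
noncomputable def listBoundary : List α → ListChain α
  | [] => 0
  | x :: l => .single l 1 - cons x (listBoundary l)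

/-- The boundary map on list chains. -/
noncomputable def d : ListChain α →ₗ[ℤ] ListChain α := extend listBoundary

@[simp] theorem d_nil : d (.single ([] : List α) 1) = 0 := by simp [d, listBoundary]

theorem d_cons (x : α) (y : ListChain α) : d (cons x y) = y - cons x (d y) := by
  have : d.comp (cons x) = LinearMap.id - (cons x).comp (d : ListChain α →ₗ[ℤ] _) :=
    hom_ext fun l => by simp [d, listBoundary]
  exact LinearMap.congr_fun this y

theorem d_single_cons (x : α) (l : List α) :
    d (.single (x :: l) 1) = .single l 1 - cons x (d (.single l 1)) := by
  rw [← cons_single, d_cons]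

theorem d_d (y : ListChain α) : d (d y) = 0 := by
  have : (d : ListChain α →ₗ[ℤ] _).comp d = 0 := hom_ext fun l => by
    induction l with
    | nil => simp
    | cons x l ih =>
      rw [LinearMap.comp_apply] at ih
      simp [d_single_cons, d_cons, ih]
  exact LinearMap.congr_fun this y

/-- Concatenation of lists, extended bilinearly. -/
noncomputable def cat : ListChain α →ₗ[ℤ] ListChain α →ₗ[ℤ] ListChain α :=
  Finsupp.linearCombination ℤ fun l => Finsupp.lmapDomain ℤ ℤ (l ++ ·)

@[simp] theorem cat_single (l₁ l₂ : List α) :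
    cat (.single l₁ 1) (.single l₂ 1) = .single (l₁ ++ l₂) 1 := by
  simp [cat]

theorem cat_nil (y : ListChain α) : cat (.single [] 1) y = y := by
  have : cat (.single ([] : List α) 1) = LinearMap.id := hom_ext fun l => by simp
  exact LinearMap.congr_fun this y

theorem cat_cons (x : α) (y z : ListChain α) : cat (cons x y) z = cons x (cat y z) := by
  have : (cat (α := α)).comp (cons x) = (LinearMap.llcomp ℤ _ _ _ (cons x)).comp cat :=
    hom_ext fun l => hom_ext fun l' => by simp
  exact LinearMap.congr_fun (LinearMap.congr_fun this y) z

theorem d_cat_single (l : List α) (y : ListChain α) :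
    d (cat (.single l 1) y) =
      cat (d (.single l 1)) y + (-1 : ℤ) ^ l.length • cat (.single l 1) (d y) := by
  induction l with
  | nil => simp [cat_nil]
  | cons x l ih =>
    rw [← cons_single, cat_cons, cat_cons, d_cons, d_cons, ih]
    simp [cat_cons, pow_succ, sub_eq_add_neg]
    abel

/-- The Leibniz rule for a chain on lists of constant length. -/
theorem d_cat {p : ℕ} {x : ListChain α}
    (hx : x ∈ Finsupp.supported ℤ ℤ {l : List α | l.length = p}) (y : ListChain α) :
    d (cat x y) = cat (d x) y + (-1 : ℤ) ^ p • cat x (d y) := by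
  have := eq_of_mem_supported (f := d.comp (cat.flip y))
    (g := (cat.flip y).comp d + (-1 : ℤ) ^ p • cat.flip (d y)) (fun l hl => ?_) hx
  · simpa only [LinearMap.comp_apply, LinearMap.add_apply, LinearMap.smul_apply,
      LinearMap.flip_apply] using this
  · obtain rfl : l.length = p := hl
    simpa only [LinearMap.comp_apply, LinearMap.add_apply, LinearMap.smul_apply,
      LinearMap.flip_apply] using d_cat_single l y

/-- The number of lists occurring in a chain; it bounds the support of the corresponding oriented
chain. -/
def size (x : ListChain α) : ℕ := x.support.card

theorem size_add (x y : ListChain α) : size (x + y) ≤ size x + size y := by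
  classical
  exact (Finset.card_le_card Finsupp.support_add).trans (Finset.card_union_le _ _)

@[simp] theorem size_neg (x : ListChain α) : size (-x) = size x := by simp [size]

theorem size_sub (x y : ListChain α) : size (x - y) ≤ size x + size y := by
  simpa [sub_eq_add_neg] using size_add x (-y)

theorem size_smul (a : ℤ) (x : ListChain α) : size (a • x) ≤ size x :=
  Finset.card_le_card Finsupp.support_smul

@[simp] theorem size_single (l : List α) : size (.single l 1) = 1 := by
  simp [size, Finsupp.support_single]

@[simp] theorem size_zero : size (0 : ListChain α) = 0 := by simp [size]

theorem size_sum_le {β : Type*} (s : Finset β) (f : β → ListChain α) :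
    size (∑ i ∈ s, f i) ≤ ∑ i ∈ s, size (f i) := by
  classical
  induction s using Finset.induction_on with
  | empty => simp
  | insert a s ha ih =>
    rw [Finset.sum_insert ha, Finset.sum_insert ha]
    exact (size_add _ _).trans (by omega)

theorem size_map_le {s : Set (List α)} {f : ListChain α →ₗ[ℤ] ListChain α} {R : ℕ}
    (h : ∀ l ∈ s, size (f (.single l 1)) ≤ R) {x : ListChain α}
    (hx : x ∈ Finsupp.supported ℤ ℤ s) : size (f x) ≤ size x * R := by
  have hx' : x = ∑ l ∈ x.support, x l • Finsupp.single l 1 := by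
    conv_lhs => rw [← Finsupp.sum_single x]
    simp [Finsupp.sum]
  conv_lhs => rw [hx', map_sum]
  refine (size_sum_le _ _).trans ?_
  rw [size, ← smul_eq_mul, ← Finset.sum_const]
  refine Finset.sum_le_sum fun l hl => ?_
  rw [map_smul]
  exact (size_smul _ _).trans (h l (hx hl))

theorem size_cat_single_le (l : List α) (y : ListChain α) :
    size (cat (.single l 1) y) ≤ size y := by
  simpa using size_map_le (s := Set.univ) (f := cat (.single l 1)) (R := 1)
    (fun l' _ => by simp) (x := y) (by simp)

theorem size_cat_le (x y : ListChain α) : size (cat x y) ≤ size x * size y := by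
  simpa using size_map_le (s := Set.univ) (f := cat.flip y) (R := size y)
    (fun l _ => by simpa using size_cat_single_le l y) (x := x) (by simp)

theorem size_cons_le (x : α) (y : ListChain α) : size (cons x y) ≤ size y := by
  simpa using size_map_le (s := Set.univ) (f := cons x) (R := 1)
    (fun l' _ => by simp) (x := y) (by simp)

/-- The boundary of a list is supported on sublists with one element removed. -/
theorem d_single_mem_supported (l : List α) :
    d (.single l 1) ∈
      Finsupp.supported ℤ ℤ {l' : List α | l'.Sublist l ∧ l'.length + 1 = l.length} := by
  induction l with
  | nil => simp
  | cons x l ih =>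
    rw [d_single_cons]
    refine Submodule.sub_mem _ (Finsupp.single_mem_supported ℤ 1 ⟨List.sublist_cons_self x l, rfl⟩)
      (map_mem_of_mem_supported (f := cons x) (fun l' hl' => ?_) ih)
    rw [cons_single]
    exact Finsupp.single_mem_supported ℤ 1 ⟨hl'.1.cons_cons x, by simp [hl'.2]⟩

theorem size_d_single_le (l : List α) : size (d (.single l 1)) ≤ l.length := by
  induction l with
  | nil => simp
  | cons x l ih =>
    rw [d_single_cons, List.length_cons]
    refine (size_sub _ _).trans ?_
    have := size_cons_le x (d (.single l 1))
    simp only [size_single]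
    omega

theorem d_single_ofFn {p : ℕ} (v : Fin (p + 1) → α) :
    d (.single (List.ofFn v) 1) =
      ∑ i : Fin (p + 1), (-1 : ℤ) ^ (i : ℕ) •
        (.single (List.ofFn (v ∘ i.succAbove)) 1 : ListChain α) := by
  induction p with
  | zero =>
    rw [List.ofFn_succ, d_single_cons]
    simp
  | succ p ih =>
    rw [List.ofFn_succ, d_single_cons, ih, Fin.sum_univ_succ (n := p + 1), map_sum,
      sub_eq_add_neg, ← Finset.sum_neg_distrib]
    congr 1
    · simp [Function.comp_def]
    · refine Finset.sum_congr rfl fun i _ => ?_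
      have : List.ofFn (v ∘ i.succ.succAbove) =
          v 0 :: List.ofFn ((fun j => v j.succ) ∘ i.succAbove) := by
        rw [List.ofFn_succ]
        simp [Function.comp_def]
      rw [this, map_smul, cons_single, Fin.val_succ, pow_succ, mul_neg_one, neg_smul]

end ListChain

theorem exists_ofFn {l : List α} {p : ℕ} (h : l.length = p) : ∃ v : Fin p → α, l = List.ofFn v := by
  subst h
  exact ⟨l.get, (List.ofFn_get l).symm⟩

theorem exists_perm_of_elementary_ne_zero {X : PreAbstractSimplicialComplex α} {p : ℕ}
    (σ : OrderedSimplex X p) {w : Fin p → α}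
    (h : (elementary σ : (Fin p → α) →₀ ℤ) w ≠ 0) : ∃ γ : Equiv.Perm (Fin p), σ.1 ∘ γ = w := by
  rw [elementary, Finsupp.finsetSum_apply] at h
  obtain ⟨γ, -, hγ⟩ := Finset.exists_ne_zero_of_sum_ne_zero h
  refine ⟨γ, ?_⟩
  by_contra hcon
  exact hγ (by simp [hcon])

end FlagChains

end ConeRadius

/-! ### Flags and cone functions on them -/

namespace ConeRadius

section FlagCones

open ListChain

variable {α : Type*} [PartialOrder α]

/-- `l` lists a flag of elements of `S` in increasing order. -/
def IsFlag (S : Set α) (l : List α) : Prop := l.Pairwise (· < ·) ∧ ∀ x ∈ l, x ∈ S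

namespace IsFlag

variable {S T : Set α} {l l' : List α}

theorem nil : IsFlag S [] := ⟨List.Pairwise.nil, by simp⟩

theorem mono (h : IsFlag S l) (hST : S ⊆ T) : IsFlag T l := ⟨h.1, fun x hx => hST (h.2 x hx)⟩

theorem sublist (h : IsFlag S l) (hl : l'.Sublist l) : IsFlag S l' :=
  ⟨h.1.sublist hl, fun x hx => h.2 x (hl.subset hx)⟩

theorem append (h : IsFlag S l) (h' : IsFlag S l') (hlt : ∀ x ∈ l, ∀ y ∈ l', x < y) :
    IsFlag S (l ++ l') :=
  ⟨List.pairwise_append.2 ⟨h.1, h'.1, hlt⟩, fun x hx =>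
    (List.mem_append.1 hx).elim (h.2 x) (h'.2 x)⟩

end IsFlag

namespace ListChain

/-- The chains on flags of `S` with `p` elements. -/
noncomputable def flagChains (S : Set α) (p : ℕ) : Submodule ℤ (ListChain α) :=
  Finsupp.supported ℤ ℤ {l | IsFlag S l ∧ l.length = p}

theorem single_mem_flagChains {S : Set α} {l : List α} (h : IsFlag S l) {p : ℕ}
    (hp : l.length = p) : (.single l 1 : ListChain α) ∈ flagChains S p :=
  Finsupp.single_mem_supported ℤ 1 ⟨h, hp⟩

theorem flagChains_mono {S T : Set α} (h : S ⊆ T) (p : ℕ) : flagChains S p ≤ flagChains T p :=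
  Finsupp.supported_mono fun _ hl => ⟨hl.1.mono h, hl.2⟩

theorem d_single_mem_flags {S : Set α} {l : List α} (h : IsFlag S l) :
    d (.single l 1) ∈ Finsupp.supported ℤ ℤ {l' | IsFlag S l' ∧ l'.length + 1 = l.length} :=
  mem_supported_of_forall (d_single_mem_supported l) fun _ hl' => ⟨h.sublist hl'.1, hl'.2⟩

theorem d_mem_flagChains {S : Set α} {p : ℕ} {x : ListChain α} (hx : x ∈ flagChains S (p + 1)) :
    d x ∈ flagChains S p := by
  refine map_mem_of_mem_supported (f := d) (fun l hl => ?_) hx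
  exact mem_supported_of_forall (d_single_mem_flags hl.1)
    fun _ hl' => ⟨hl'.1, Nat.succ_injective (hl'.2.trans hl.2)⟩

end ListChain

/-- `k` is a cone function on the flags of `S` with fewer than `m` elements, with all radii at most
`R`.  It is defined on all list chains; only its values on these flags matter. -/
structure IsCone (S : Set α) (m R : ℕ) (k : ListChain α →ₗ[ℤ] ListChain α) : Prop where
  mem : ∀ l, IsFlag S l → l.length < m → k (.single l 1) ∈ flagChains S (l.length + 1)
  eq : ∀ l, IsFlag S l → l.length < m →
    d (k (.single l 1)) + k (d (.single l 1)) = .single l 1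
  size_le : ∀ l, IsFlag S l → l.length < m → size (k (.single l 1)) ≤ R
  apex : 0 < m → ∃ v, k (.single [] 1) = .single [v] 1

/-- The flag complex of `S` has a cone function in the degrees below `m` whose radii are at
most `R`. -/
def HasCone (S : Set α) (m R : ℕ) : Prop := ∃ k, IsCone S m R k

theorem HasCone.mono {S : Set α} {m R R' : ℕ} (h : HasCone S m R) (hR : R ≤ R') :
    HasCone S m R' := by
  obtain ⟨k, hk⟩ := h
  exact ⟨k, hk.mem, hk.eq, fun l hl hm => (hk.size_le l hl hm).trans hR, hk.apex⟩

theorem hasCone_zero (S : Set α) (R : ℕ) : HasCone S 0 R :=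
  ⟨0, fun _ _ h => absurd h (Nat.not_lt_zero _), fun _ _ h => absurd h (Nat.not_lt_zero _),
    fun _ _ h => absurd h (Nat.not_lt_zero _), fun h => absurd h (Nat.not_lt_zero _)⟩

theorem IsCone.d_apply {S : Set α} {m R : ℕ} {k : ListChain α →ₗ[ℤ] ListChain α}
    (hk : IsCone S m R k) {x : ListChain α}
    (hx : x ∈ Finsupp.supported ℤ ℤ {l | IsFlag S l ∧ l.length < m}) :
    d (k x) = x - k (d x) := by
  have := eq_of_mem_supported (f := d.comp k) (g := LinearMap.id - k.comp d)
    (fun l hl => by simpa using eq_sub_of_add_eq (hk.eq l hl.1 hl.2)) hx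
  simpa using this

open Classical in
/-- Insert `U` into an increasing list. -/
noncomputable def insertSorted (U : α) : List α → ListChain α
  | [] => .single [U] 1
  | x :: l => if x < U then -cons x (insertSorted U l) else .single (U :: x :: l) 1

namespace ListChain

/-- The oriented join `x ↦ [U, x]` with the vertex `U`, rewritten on increasing lists: inserting `U`
behind `i` elements contributes the sign `(-1) ^ i`. -/
noncomputable def ins (U : α) : ListChain α →ₗ[ℤ] ListChain α := extend (insertSorted U)

theorem ins_nil (U : α) : ins U (.single [] 1) = .single [U] 1 := by simp [ins, insertSorted]

theorem ins_cons_of_lt {U x : α} (h : x < U) (y : ListChain α) :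
    ins U (cons x y) = -cons x (ins U y) := by
  have : (ins U).comp (cons x) = -(cons x).comp (ins U) :=
    hom_ext fun l => by simp [ins, insertSorted, h]
  exact LinearMap.congr_fun this y

theorem ins_of_not_lt {U : α} {y : ListChain α}
    (hy : y ∈ Finsupp.supported ℤ ℤ {l : List α | ∀ x ∈ l, ¬ x < U}) : ins U y = cons U y := by
  refine eq_of_mem_supported (fun l hl => ?_) hy
  cases l with
  | nil => simp [ins, insertSorted]
  | cons x l =>
    have : ¬ x < U := hl x (by simp)
    simp [ins, insertSorted, this]

theorem ins_append {U : α} {a b : List α} (ha : ∀ x ∈ a, x < U) (hb : ∀ x ∈ b, ¬ x < U) :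
    ins U (.single (a ++ b) 1) = (-1 : ℤ) ^ a.length • .single (a ++ U :: b) 1 := by
  induction a with
  | nil => simpa using ins_of_not_lt (Finsupp.single_mem_supported ℤ (1 : ℤ) hb)
  | cons x a ih =>
    rw [List.cons_append, ← cons_single, ins_cons_of_lt (ha x (by simp)),
      ih fun y hy => ha y (by simp [hy]), map_smul, cons_single]
    simp [pow_succ]

/-- The cone with apex `U`, formed by joining with `U`, contracts the increasing lists. -/
theorem d_ins_single {U : α} {l : List α} (h : l.Pairwise (· < ·)) :
    d (ins U (.single l 1)) = .single l 1 - ins U (d (.single l 1)) := by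
  induction l with
  | nil => simp [ins_nil, ← cons_single, d_cons]
  | cons x l ih =>
    by_cases hx : x < U
    · rw [← cons_single, ins_cons_of_lt hx, map_neg, d_cons, d_cons, ih h.of_cons, map_sub,
        map_sub (ins U), ins_cons_of_lt hx]
      abel
    · have hl : ∀ y ∈ x :: l, ¬ y < U := by
        intro y hy hyU
        rcases List.mem_cons.1 hy with rfl | hy
        · exact hx hyU
        · exact hx ((List.rel_of_pairwise_cons h hy).trans hyU)
      rw [ins_of_not_lt (Finsupp.single_mem_supported ℤ 1 hl), d_cons, ins_of_not_lt]
      exact mem_supported_of_forall (d_single_mem_supported _)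
        fun l' hl' y hy => hl y (hl'.1.subset hy)

theorem d_ins {S : Set α} {p : ℕ} {U : α} {x : ListChain α} (hx : x ∈ flagChains S p) :
    d (ins U x) = x - ins U (d x) := by
  have := eq_of_mem_supported (f := d.comp (ins U)) (g := LinearMap.id - (ins U).comp d)
    (fun l hl => by simpa using d_ins_single hl.1.1) hx
  simpa using this

end ListChain

/-- A flag of elements comparable with and distinct from `U` splits into a part below and a part
above `U`. -/
theorem IsFlag.exists_split {S : Set α} {U : α} (hS : ∀ x ∈ S, x < U ∨ U < x) {l : List α}
    (hl : IsFlag S l) :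
    ∃ a b : List α, l = a ++ b ∧ (∀ x ∈ a, x < U) ∧ ∀ x ∈ b, U < x := by
  induction l with
  | nil => exact ⟨[], [], by simp⟩
  | cons x l ih =>
    rcases hS x (hl.2 x (by simp)) with hx | hx
    · obtain ⟨a, b, rfl, ha, hb⟩ := ih (hl.sublist (List.sublist_cons_self x l))
      exact ⟨x :: a, b, rfl, by simpa [hx] using ha, hb⟩
    · refine ⟨[], x :: l, rfl, by simp, fun y hy => ?_⟩
      rcases List.mem_cons.1 hy with rfl | hy
      · exact hx
      · exact hx.trans (List.rel_of_pairwise_cons hl.1 hy)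

/-- A flag containing `U` is, up to sign, obtained by inserting `U` into a flag of elements
comparable with `U`. -/
theorem IsFlag.eq_smul_ins {S : Set α} {U : α} {l : List α} (hl : IsFlag S l) (hU : U ∈ l) :
    ∃ l' : List α, IsFlag {W ∈ S | W < U ∨ U < W} l' ∧ l.length = l'.length + 1 ∧
      ∃ e : ℤˣ, (.single l 1 : ListChain α) = e • ins U (.single l' 1) := by
  obtain ⟨a, b, rfl⟩ := List.append_of_mem hU
  obtain ⟨h, hS⟩ := hl
  obtain ⟨ha, hb, hab⟩ := List.pairwise_append.1 h
  have haU : ∀ x ∈ a, x < U := fun x hx => hab x hx U (by simp)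
  have hbU : ∀ x ∈ b, U < x := fun x hx => List.rel_of_pairwise_cons hb hx
  refine ⟨a ++ b, ⟨List.pairwise_append.2 ⟨ha, hb.of_cons, fun x hx y hy =>
    hab x hx y (by simp [hy])⟩, fun x hx => ?_⟩, by simp; omega, (-1) ^ a.length, ?_⟩
  · rcases List.mem_append.1 hx with hx | hx
    · exact ⟨hS x (by simp [hx]), Or.inl (haU x hx)⟩
    · exact ⟨hS x (by simp [hx]), Or.inr (hbU x hx)⟩
  · rw [ins_append haU fun x hx => (hbU x hx).not_gt, Units.smul_def, smul_smul]
    push_cast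
    rw [← mul_pow]
    simp

theorem IsFlag.exists_ins {S : Set α} {U : α} {l' : List α}
    (hl' : IsFlag {W ∈ S | W < U ∨ U < W} l') :
    ∃ l : List α, IsFlag (insert U S) l ∧ l.length = l'.length + 1 ∧ U ∈ l ∧
      ∃ e : ℤˣ, ins U (.single l' 1) = e • (.single l 1 : ListChain α) := by
  obtain ⟨a, b, rfl, ha, hb⟩ := hl'.exists_split fun x hx => hx.2
  refine ⟨a ++ U :: b, ?_, by simp; omega, by simp, (-1) ^ a.length, ?_⟩
  · obtain ⟨h, hS⟩ := hl'
    obtain ⟨h1, h2, h3⟩ := List.pairwise_append.1 h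
    refine ⟨List.pairwise_append.2 ⟨h1, List.pairwise_cons.2 ⟨hb, h2⟩, fun x hx y hy => ?_⟩, ?_⟩
    · rcases List.mem_cons.1 hy with rfl | hy
      · exact ha x hx
      · exact h3 x hx y hy
    · intro x hx
      simp only [List.mem_append, List.mem_cons] at hx
      rcases hx with hx | rfl | hx
      · exact Or.inr (hS x (by simp [hx])).1
      · exact Or.inl rfl
      · exact Or.inr (hS x (by simp [hx])).1
  · rw [ins_append ha fun x hx => (hb x hx).not_gt, Units.smul_def]
    push_cast
    rfl

open Classical in
/-- A left inverse of joining with `U`. -/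
noncomputable def ListChain.removeVertex (U : α) : ListChain α →ₗ[ℤ] ListChain α :=
  extend fun l => (-1 : ℤ) ^ (l.filter (· < U)).length • .single (l.filter (· ≠ U)) 1

theorem IsFlag.removeVertex_ins {S : Set α} {U : α} {l : List α}
    (hl : IsFlag {W ∈ S | W < U ∨ U < W} l) :
    removeVertex U (ins U (.single l 1)) = .single l 1 := by
  classical
  obtain ⟨a, b, rfl, ha, hb⟩ := hl.exists_split fun x hx => hx.2
  have e1 : (a ++ U :: b).filter (· < U) = a := by
    rw [List.filter_append, List.filter_cons_of_neg (by simp),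
      List.filter_eq_self.2 fun x hx => by simpa using ha x hx,
      List.filter_eq_nil_iff.2 fun x hx => by simpa using (hb x hx).not_gt, List.append_nil]
  have e2 : (a ++ U :: b).filter (· ≠ U) = a ++ b := by
    rw [List.filter_append, List.filter_cons_of_neg (by simp),
      List.filter_eq_self.2 fun x hx => by simpa using (ha x hx).ne,
      List.filter_eq_self.2 fun x hx => by simpa using (hb x hx).ne']
  rw [ins_append ha fun x hx => (hb x hx).not_gt, map_smul, removeVertex, extend_single, smul_smul]
  convert one_smul ℤ _
  · convert (mul_pow (-1 : ℤ) (-1) a.length).symm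
    simp
  · convert e2.symm

theorem IsFlag.comparable {S : Set α} {l : List α} (hl : IsFlag S l) {x y : α} (hx : x ∈ l)
    (hy : y ∈ l) (hne : x ≠ y) : x < y ∨ y < x := by
  have h : l.Pairwise fun a b => a < b ∨ b < a := hl.1.imp fun h => Or.inl h
  have : Std.Symm fun a b : α => a < b ∨ b < a := ⟨fun _ _ => Or.symm⟩
  exact h.forall hx hy hne

end FlagCones

end ConeRadius

/-! ### Constructions of cone functions: apices, joins, attached vertices -/

namespace ConeRadius

section FlagConeConstructions

open ListChain

variable {α : Type*} [PartialOrder α]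

open Classical in
/-- A flag complex with a vertex comparable to all others is a cone. -/
theorem hasCone_of_comparable {S : Set α} {M : α} (hM : M ∈ S)
    (h : ∀ x ∈ S, x ≠ M → x < M ∨ M < x) (m : ℕ) : HasCone S m 1 := by
  set k : ListChain α →ₗ[ℤ] ListChain α :=
    extend fun l => if M ∈ l then 0 else ins M (.single l 1) with hk
  have hk0 : ∀ l, M ∈ l → k (.single l 1) = 0 := fun l hl => by simp [hk, hl]
  have hk1 : ∀ l, M ∉ l → k (.single l 1) = ins M (.single l 1) := fun l hl => by simp [hk, hl]
  have hlink : ∀ l, IsFlag S l → M ∉ l → IsFlag {W ∈ S | W < M ∨ M < W} l := fun l hl hMl =>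
    ⟨hl.1, fun x hx => ⟨hl.2 x hx, h x (hl.2 x hx) fun hxM => hMl (hxM ▸ hx)⟩⟩
  refine ⟨k, fun l hl _ => ?_, fun l hl _ => ?_, fun l hl _ => ?_, fun _ => ⟨M, ?_⟩⟩
  · by_cases hMl : M ∈ l
    · rw [hk0 l hMl]
      exact Submodule.zero_mem _
    · rw [hk1 l hMl]
      obtain ⟨l₁, h1, h2, -, e, he⟩ := (hlink l hl hMl).exists_ins
      rw [he]
      refine Submodule.smul_mem _ (e : ℤ) (single_mem_flagChains ?_ h2)
      rwa [Set.insert_eq_of_mem hM] at h1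
  · by_cases hMl : M ∈ l
    · obtain ⟨l', h1, -, e, he⟩ := hl.eq_smul_ins hMl
      have hMl' : M ∉ l' := fun hm => by simpa using (h1.2 M hm).2
      have hz : k (ins M (d (.single l' 1))) = 0 := by
        have hd := d_single_mem_flags h1
        have := eq_of_mem_supported (f := k.comp (ins M)) (g := 0) (fun l₁ hl₁ => ?_) hd
        · simpa using this
        · obtain ⟨l₂, -, -, h3, e', he'⟩ := hl₁.1.exists_ins
          rw [LinearMap.comp_apply, he', Units.smul_def, map_smul, hk0 l₂ h3]
          simp
      rw [hk0 l hMl, map_zero, zero_add, he, Units.smul_def, map_smul, map_smul,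
        d_ins_single h1.1, map_sub, hz, sub_zero, hk1 l' hMl']
    · rw [hk1 l hMl, d_ins_single hl.1]
      rw [eq_of_mem_supported (f := k) (g := ins M) (fun l' hl' => ?_)
        (d_single_mem_supported l)]
      · abel
      · exact hk1 l' fun hm => hMl (hl'.1.subset hm)
  · by_cases hMl : M ∈ l
    · simp [hk0 l hMl]
    · rw [hk1 l hMl]
      obtain ⟨l₁, h1, h2, -, e, he⟩ := (hlink l hl hMl).exists_ins
      rw [he, Units.smul_def]
      exact (size_smul _ _).trans (by simp)
  · rw [hk1 _ (by simp), ins_nil]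

theorem cat_mem_flagChains {S₁ S₂ : Set α} (hlt : ∀ x ∈ S₁, ∀ y ∈ S₂, x < y) {p q r : ℕ}
    {x y : ListChain α} (hx : x ∈ flagChains S₁ p) (hy : y ∈ flagChains S₂ q) (hr : p + q = r) :
    cat x y ∈ flagChains (S₁ ∪ S₂) r := by
  refine map_mem_of_mem_supported (f := cat.flip y) (fun l₁ h₁ => ?_) hx
  refine map_mem_of_mem_supported (f := cat (.single l₁ 1)) (fun l₂ h₂ => ?_) hy
  rw [cat_single]
  exact single_mem_flagChains ((h₁.1.mono Set.subset_union_left).append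
    (h₂.1.mono Set.subset_union_right) fun x hx y hy => hlt x (h₁.1.2 x hx) y (h₂.1.2 y hy))
    (by simp [h₁.2, h₂.2, hr])

theorem IsFlag.exists_append_of_union {S₁ S₂ : Set α} (hlt : ∀ x ∈ S₁, ∀ y ∈ S₂, x < y)
    {l : List α} (hl : IsFlag (S₁ ∪ S₂) l) :
    ∃ a b, l = a ++ b ∧ IsFlag S₁ a ∧ IsFlag S₂ b := by
  induction l with
  | nil => exact ⟨[], [], rfl, IsFlag.nil, IsFlag.nil⟩
  | cons x l ih =>
    rcases hl.2 x (by simp) with hx | hx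
    · obtain ⟨a, b, rfl, ha, hb⟩ := ih (hl.sublist (List.sublist_cons_self x l))
      refine ⟨x :: a, b, rfl, ⟨List.pairwise_cons.2 ⟨fun y hy =>
        List.rel_of_pairwise_cons hl.1 (by simp [hy]), ha.1⟩, ?_⟩, hb⟩
      simpa [hx] using ha.2
    · refine ⟨[], x :: l, rfl, IsFlag.nil, hl.1, fun y hy => ?_⟩
      rcases List.mem_cons.1 hy with rfl | hy'
      · exact hx
      · rcases hl.2 y hy with h | h
        · exact absurd ((hlt y h x hx).trans (List.rel_of_pairwise_cons hl.1 hy')) (lt_irrefl y)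
        · exact h

open Classical in
/-- Cone functions on two flag complexes give one on their join: cone off the first factor as long
as the degree allows, and for a top-dimensional `x` in the first factor join the cycle
`x - k₁ ∂ x` with the cone of the second factor. -/
theorem HasCone.join {S₁ S₂ : Set α} {m₁ m₂ R₁ R₂ : ℕ} (hlt : ∀ x ∈ S₁, ∀ y ∈ S₂, x < y)
    (hm : ∀ l, IsFlag S₁ l → l.length ≤ m₁) (h₁ : HasCone S₁ m₁ R₁) (h₂ : HasCone S₂ m₂ R₂) :
    HasCone (S₁ ∪ S₂) (m₁ + m₂) (R₁ + (1 + m₁ * R₁) * R₂) := by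
  obtain ⟨k₁, hk₁⟩ := h₁
  obtain ⟨k₂, hk₂⟩ := h₂
  let z : ListChain α →ₗ[ℤ] ListChain α := LinearMap.id - k₁.comp d
  set k : ListChain α →ₗ[ℤ] ListChain α := extend fun l =>
    if (l.filter (· ∈ S₁)).length < m₁ then
      cat (k₁ (.single (l.filter (· ∈ S₁)) 1)) (.single (l.filter (· ∉ S₁)) 1)
    else (-1 : ℤ) ^ m₁ • cat (z (.single (l.filter (· ∈ S₁)) 1))
      (k₂ (.single (l.filter (· ∉ S₁)) 1)) with hk
  have hnot : ∀ y ∈ S₂, y ∉ S₁ := fun y h2 h1 => lt_irrefl y (hlt y h1 y h2)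
  have hfil : ∀ a b, IsFlag S₁ a → IsFlag S₂ b →
      (a ++ b).filter (· ∈ S₁) = a ∧ (a ++ b).filter (· ∉ S₁) = b := by
    intro a b ha hb
    have e1 : a.filter (· ∈ S₁) = a := List.filter_eq_self.2 fun x hx => by simpa using ha.2 x hx
    have e2 : b.filter (· ∈ S₁) = [] :=
      List.filter_eq_nil_iff.2 fun x hx => by simpa using hnot x (hb.2 x hx)
    have e3 : a.filter (· ∉ S₁) = [] :=
      List.filter_eq_nil_iff.2 fun x hx => by simpa using ha.2 x hx
    have e4 : b.filter (· ∉ S₁) = b :=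
      List.filter_eq_self.2 fun x hx => by simpa using hnot x (hb.2 x hx)
    rw [List.filter_append, List.filter_append, e1, e2, e3, e4]
    simp
  have klo : ∀ a b, IsFlag S₁ a → IsFlag S₂ b → a.length < m₁ →
      k (.single (a ++ b) 1) = cat (k₁ (.single a 1)) (.single b 1) := by
    intro a b ha hb hlen
    obtain ⟨e1, e2⟩ := hfil a b ha hb
    rw [hk, extend_single, e1, e2, if_pos hlen]
  have khi : ∀ a b, IsFlag S₁ a → IsFlag S₂ b → a.length = m₁ →
      k (.single (a ++ b) 1) =
        (-1 : ℤ) ^ m₁ • cat (z (.single a 1)) (k₂ (.single b 1)) := by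
    intro a b ha hb hlen
    obtain ⟨e1, e2⟩ := hfil a b ha hb
    rw [hk, extend_single, e1, e2, if_neg (by omega)]
  -- The values of `k` on the two parts `∂ a * b` and `a * ∂ b` of a boundary.
  have kleft : ∀ a b, IsFlag S₁ a → IsFlag S₂ b →
      k (cat (d (.single a 1)) (.single b 1)) = cat (k₁ (d (.single a 1))) (.single b 1) := by
    intro a b ha hb
    refine eq_of_mem_supported (f := k.comp (cat.flip (.single b 1)))
      (g := (cat.flip (.single b 1)).comp k₁) (fun a' ha' => ?_) (d_single_mem_flags ha)
    have hlen : a'.length < m₁ := by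
      have := hm a ha
      have := ha'.2
      omega
    simpa using klo a' b ha'.1 hb hlen
  have krlo : ∀ a b, IsFlag S₁ a → IsFlag S₂ b → a.length < m₁ →
      k (cat (.single a 1) (d (.single b 1))) = cat (k₁ (.single a 1)) (d (.single b 1)) := by
    intro a b ha hb hlen
    refine eq_of_mem_supported (f := k.comp (cat (.single a 1)))
      (g := cat (k₁ (.single a 1))) (fun b' hb' => ?_) (d_single_mem_flags hb)
    simpa using klo a b' ha hb'.1 hlen
  have krhi : ∀ a b, IsFlag S₁ a → IsFlag S₂ b → a.length = m₁ →
      k (cat (.single a 1) (d (.single b 1))) =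
        (-1 : ℤ) ^ m₁ • cat (z (.single a 1)) (k₂ (d (.single b 1))) := by
    intro a b ha hb hlen
    refine eq_of_mem_supported (f := k.comp (cat (.single a 1)))
      (g := (-1 : ℤ) ^ m₁ • (cat (z (.single a 1))).comp k₂) (fun b' hb' => ?_)
      (d_single_mem_flags hb)
    simpa only [LinearMap.comp_apply, cat_single, LinearMap.smul_apply] using
      khi a b' ha hb'.1 hlen
  have hzmem : ∀ a, IsFlag S₁ a → z (.single a 1) ∈ flagChains S₁ a.length := by
    intro a ha
    refine Submodule.sub_mem _ (single_mem_flagChains ha rfl) ?_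
    refine map_mem_of_mem_supported (f := k₁) (fun a' ha' => ?_) (d_single_mem_flags ha)
    have hlen : a'.length < m₁ := by
      have := hm a ha
      have := ha'.2
      omega
    rw [← ha'.2]
    exact hk₁.mem a' ha'.1 hlen
  have hdlen : ∀ a, IsFlag S₁ a → d (.single a 1) ∈
      Finsupp.supported ℤ ℤ {l | IsFlag S₁ l ∧ l.length < m₁} := by
    intro a ha
    refine mem_supported_of_forall (d_single_mem_flags ha) fun a' ha' => ⟨ha'.1, ?_⟩
    have := hm a ha
    have := ha'.2
    omega
  have hzd : ∀ a, IsFlag S₁ a → d (z (.single a 1)) = 0 := by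
    intro a ha
    have := hk₁.d_apply (hdlen a ha)
    simp only [z, LinearMap.sub_apply, LinearMap.id_apply, LinearMap.comp_apply, map_sub, this,
      d_d, map_zero, sub_zero, sub_self]
  have hsq : (-1 : ℤ) ^ m₁ * (-1 : ℤ) ^ m₁ = 1 := by rw [← mul_pow]; simp
  refine ⟨k, fun l hl hlen => ?_, fun l hl hlen => ?_, fun l hl hlen => ?_, fun hpos => ?_⟩
  · obtain ⟨a, b, rfl, ha, hb⟩ := hl.exists_append_of_union hlt
    rw [List.length_append] at hlen
    rcases (hm a ha).lt_or_eq with h | h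
    · rw [klo a b ha hb h]
      exact cat_mem_flagChains hlt (hk₁.mem a ha h) (single_mem_flagChains hb rfl)
        (by simp; omega)
    · rw [khi a b ha hb h]
      exact Submodule.smul_mem _ _ (cat_mem_flagChains hlt (hzmem a ha)
        (hk₂.mem b hb (by omega)) (by simp; omega))
  · obtain ⟨a, b, rfl, ha, hb⟩ := hl.exists_append_of_union hlt
    rw [List.length_append] at hlen
    have hd : d (.single (a ++ b) 1) = cat (d (.single a 1)) (.single b 1) +
        (-1 : ℤ) ^ a.length • cat (.single a 1) (d (.single b 1)) := by
      rw [← cat_single, d_cat_single]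
    rcases (hm a ha).lt_or_eq with h | h
    · rw [hd, map_add, map_smul, kleft a b ha hb, krlo a b ha hb h, klo a b ha hb h,
        d_cat (mem_supported_of_forall (hk₁.mem a ha h) fun l hl => hl.2), pow_succ]
      have := congrArg (fun x => cat x (.single b 1)) (hk₁.eq a ha h)
      simp only [map_add, LinearMap.add_apply, cat_single] at this
      rw [← this]
      simp only [mul_neg, mul_one, neg_smul]
      abel
    · have hb' : b.length < m₂ := by omega
      rw [hd, map_add, map_smul, kleft a b ha hb, krhi a b ha hb h, khi a b ha hb h, map_smul,
        d_cat (mem_supported_of_forall (hzmem a ha) fun l hl => hl.2), hzd a ha, map_zero,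
        LinearMap.zero_apply, zero_add, h, smul_smul, smul_smul, hsq, one_smul, one_smul,
        add_left_comm, ← map_add, hk₂.eq b hb hb', ← LinearMap.add_apply, ← map_add]
      simp [z]
  · obtain ⟨a, b, rfl, ha, hb⟩ := hl.exists_append_of_union hlt
    rw [List.length_append] at hlen
    rcases (hm a ha).lt_or_eq with h | h
    · rw [klo a b ha hb h]
      have h1 := size_cat_le (k₁ (.single a 1)) (.single b 1)
      have h2 := hk₁.size_le a ha h
      rw [size_single, mul_one] at h1
      exact h1.trans (h2.trans (Nat.le_add_right _ _))
    · rw [khi a b ha hb h]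
      refine (size_smul _ _).trans ((size_cat_le _ _).trans ?_)
      refine le_trans (Nat.mul_le_mul ?_ (hk₂.size_le b hb (by omega))) (Nat.le_add_left _ _)
      refine (size_sub _ _).trans ?_
      simp only [LinearMap.id_apply, size_single, LinearMap.comp_apply]
      refine Nat.add_le_add_left ?_ 1
      refine (size_map_le (fun l hl => hk₁.size_le l hl.1 hl.2) (hdlen a ha)).trans ?_
      exact Nat.mul_le_mul_right _ ((size_d_single_le a).trans (hm a ha))
  · rcases Nat.eq_zero_or_pos m₁ with h0 | h1
    · obtain ⟨v, hv⟩ := hk₂.apex (by omega)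
      refine ⟨v, ?_⟩
      have := khi [] [] IsFlag.nil IsFlag.nil (by simp [h0])
      rw [List.append_nil, hv] at this
      rw [this, h0]
      simp [z]
    · obtain ⟨v, hv⟩ := hk₁.apex h1
      refine ⟨v, ?_⟩
      have := klo [] [] IsFlag.nil IsFlag.nil (by simpa using h1)
      rw [List.append_nil, hv] at this
      rw [this]
      simp

open Classical in
/-- Attaching pairwise incomparable vertices `U` along links that have cone functions: if `c` is the
cone function of the old complex and `k` that of the link of `U`, then
`[U, x] ↦ c (k x) - [U, k x]` extends `c`. -/
theorem HasCone.attach {S N : Set α} {m R R' : ℕ} (h : HasCone S m R)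
    (hSN : ∀ U ∈ N, U ∉ S) (hN : ∀ U ∈ N, ∀ W ∈ N, ¬ U < W)
    (hlink : ∀ U ∈ N, HasCone {W ∈ S | W < U ∨ U < W} (m - 1) R') :
    HasCone (S ∪ N) m (R + (R' * R + R')) := by
  obtain ⟨c, hc⟩ := h
  choose! k hk using hlink
  have huniq : ∀ l, IsFlag (S ∪ N) l → ∀ U ∈ N, U ∈ l → ∀ W ∈ N, W ∈ l → W = U := by
    intro l hl U hU hUl W hW hWl
    by_contra hne
    rcases hl.comparable hWl hUl hne with h | h
    · exact hN W hW U hU h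
    · exact hN U hU W hW h
  have hsub : ∀ U ∈ N, ∀ l, IsFlag {W ∈ S ∪ N | W < U ∨ U < W} l →
      IsFlag {W ∈ S | W < U ∨ U < W} l := fun U hU l hl =>
    ⟨hl.1, fun x hx => ⟨(hl.2 x hx).1.resolve_right fun hxN =>
      (hl.2 x hx).2.elim (hN x hxN U hU) (hN U hU x hxN), (hl.2 x hx).2⟩⟩
  let g : α → ListChain α →ₗ[ℤ] ListChain α := fun U => (c - ins U).comp (k U)
  set f : ListChain α →ₗ[ℤ] ListChain α := extend fun l =>
    if h : ∃ U ∈ N, U ∈ l then g h.choose (removeVertex h.choose (.single l 1))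
    else c (.single l 1) with hf
  have fold : ∀ l, IsFlag S l → f (.single l 1) = c (.single l 1) := by
    intro l hl
    rw [hf, extend_single, dif_neg]
    rintro ⟨U, hU, hUl⟩
    exact hSN U hU (hl.2 U hUl)
  have fnew : ∀ U ∈ N, ∀ l, IsFlag {W ∈ S | W < U ∨ U < W} l →
      f (ins U (.single l 1)) = g U (.single l 1) := by
    intro U hU l hl
    obtain ⟨l₁, h1, -, h2, e, he⟩ := hl.exists_ins
    have h : ∃ U ∈ N, U ∈ l₁ := ⟨U, hU, h2⟩
    have hc : h.choose = U := huniq l₁ (h1.mono (Set.insert_subset (Or.inr hU)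
      Set.subset_union_left)) U hU h2 _ h.choose_spec.1 h.choose_spec.2
    have hf1 : f (.single l₁ 1) = g U (removeVertex U (.single l₁ 1)) := by
      rw [hf, extend_single, dif_pos h, hc]
    have hr := hl.removeVertex_ins
    rw [he, Units.smul_def, map_smul] at hr
    rw [he, Units.smul_def, map_smul, hf1, ← map_smul, hr]
  -- Every flag is old or, up to sign, a join with a new vertex.
  have hcases : ∀ l, IsFlag (S ∪ N) l → IsFlag S l ∨ ∃ U ∈ N, ∃ l',
      IsFlag {W ∈ S | W < U ∨ U < W} l' ∧ l.length = l'.length + 1 ∧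
      ∃ e : ℤˣ, (.single l 1 : ListChain α) = e • ins U (.single l' 1) := by
    intro l hl
    by_cases h : ∃ U ∈ N, U ∈ l
    · obtain ⟨U, hU, hUl⟩ := h
      obtain ⟨l', h1, h2, e, he⟩ := hl.eq_smul_ins hUl
      exact Or.inr ⟨U, hU, l', hsub U hU l' h1, h2, e, he⟩
    · push Not at h
      exact Or.inl ⟨hl.1, fun x hx => (hl.2 x hx).resolve_right fun hxN => h x hxN hx⟩
  have hkc : ∀ U ∈ N, ∀ l, IsFlag {W ∈ S | W < U ∨ U < W} l → l.length < m - 1 →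
      k U (.single l 1) ∈ Finsupp.supported ℤ ℤ {l | IsFlag S l ∧ l.length < m} := by
    intro U hU l hl hlen
    refine mem_supported_of_forall ((hk U hU).mem l hl hlen) fun l' hl' => ?_
    refine ⟨hl'.1.mono (Set.sep_subset _ _), ?_⟩
    have := hl'.2
    omega
  refine ⟨f, fun l hl hlen => ?_, fun l hl hlen => ?_, fun l hl hlen => ?_, fun hpos => ?_⟩
  · rcases hcases l hl with h | ⟨U, hU, l', hl', hl1, e, he⟩
    · rw [fold l h]
      exact flagChains_mono Set.subset_union_left _ (hc.mem l h hlen)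
    · rw [he, Units.smul_def, map_smul, fnew U hU l' hl']
      have hmem := (hk U hU).mem l' hl' (by omega)
      refine Submodule.smul_mem _ _ (Submodule.sub_mem _ ?_ ?_)
      · refine map_mem_of_mem_supported (f := c) (fun l₁ hl₁ => ?_) hmem
        refine flagChains_mono Set.subset_union_left _ ?_
        rw [hl1, ← hl₁.2]
        refine hc.mem l₁ (hl₁.1.mono (Set.sep_subset _ _)) ?_
        have := hl₁.2
        omega
      · refine map_mem_of_mem_supported (f := ins U) (fun l₁ hl₁ => ?_) hmem
        obtain ⟨l₂, h1, h2, -, e', he'⟩ := hl₁.1.exists_ins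
        rw [he', Units.smul_def]
        refine Submodule.smul_mem _ _ (single_mem_flagChains (h1.mono (Set.insert_subset
          (Or.inr hU) Set.subset_union_left)) ?_)
        have := hl₁.2
        omega
  · rcases hcases l hl with h | ⟨U, hU, l', hl', hl1, e, he⟩
    · rw [fold l h, eq_of_mem_supported (f := f) (g := c) (fun l₁ hl₁ => fold l₁ hl₁.1)
        (d_single_mem_flags h), hc.eq l h hlen]
    · have hlen' : l'.length < m - 1 := by omega
      rw [he, Units.smul_def, map_smul, map_smul, map_smul, map_smul, ← smul_add]
      congr 1
      have e1 := hc.d_apply (hkc U hU l' hl' hlen')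
      have e2 := d_ins (U := U) ((hk U hU).mem l' hl' hlen')
      have e3 : f (ins U (d (.single l' 1))) = g U (d (.single l' 1)) :=
        eq_of_mem_supported (f := f.comp (ins U)) (g := g U)
          (fun l₁ hl₁ => fnew U hU l₁ hl₁.1) (d_single_mem_flags hl')
      have e4 := eq_sub_of_add_eq ((hk U hU).eq l' hl' hlen')
      have e5 : f (.single l' 1) = c (.single l' 1) :=
        fold l' (hl'.mono (Set.sep_subset _ _))
      rw [fnew U hU l' hl', d_ins_single hl'.1, map_sub, e3, e5]
      simp only [g, LinearMap.comp_apply, LinearMap.sub_apply, map_sub, e1, e2]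
      rw [e4]
      simp only [map_sub]
      abel
  · rcases hcases l hl with h | ⟨U, hU, l', hl', hl1, e, he⟩
    · rw [fold l h]
      exact (hc.size_le l h hlen).trans (Nat.le_add_right _ _)
    · have hlen' : l'.length < m - 1 := by omega
      rw [he, Units.smul_def, map_smul, fnew U hU l' hl']
      refine (size_smul _ _).trans (le_trans ((size_sub _ _).trans ?_) (Nat.le_add_left _ _))
      have hs := (hk U hU).size_le l' hl' hlen'
      refine Nat.add_le_add ?_ ?_
      · exact (size_map_le (fun l hl => hc.size_le l hl.1 hl.2) (hkc U hU l' hl' hlen')).trans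
          (Nat.mul_le_mul_right _ hs)
      · refine (size_map_le (R := 1) (fun l₁ hl₁ => ?_) ((hk U hU).mem l' hl' hlen')).trans
          (by omega)
        obtain ⟨l₂, -, -, -, e', he'⟩ := hl₁.1.exists_ins
        rw [he', Units.smul_def]
        exact (size_smul _ _).trans (by simp)
  · obtain ⟨v, hv⟩ := hc.apex hpos
    exact ⟨v, by rw [fold [] IsFlag.nil, hv]⟩

/-- Attaching the vertices of `N` in the order of a rank function whose levels consist of pairwise
incomparable elements. -/
theorem HasCone.attach_ranked {S N : Set α} {m R R' : ℕ} (h : HasCone S m R)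
    (hSN : ∀ U ∈ N, U ∉ S) (ρ : α → ℕ) (hρ : ∀ U ∈ N, ∀ W ∈ N, U < W → ρ U ≠ ρ W)
    (hlink : ∀ U ∈ N,
      HasCone {W ∈ S ∪ {W ∈ N | ρ W < ρ U} | W < U ∨ U < W} (m - 1) R')
    (J : ℕ) (hJ : ∀ U ∈ N, ρ U < J) :
    HasCone (S ∪ N) m ((fun r => r + (R' * r + R'))^[J] R) := by
  have key : ∀ j, HasCone (S ∪ {W ∈ N | ρ W < j}) m ((fun r => r + (R' * r + R'))^[j] R) := by
    intro j
    induction j with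
    | zero => simpa using h
    | succ j ih =>
      rw [Function.iterate_succ_apply']
      have hset : S ∪ {W ∈ N | ρ W < j + 1} =
          (S ∪ {W ∈ N | ρ W < j}) ∪ {W ∈ N | ρ W = j} := by
        ext W
        simp only [Set.mem_union, Set.mem_sep_iff, Nat.lt_succ_iff_lt_or_eq]
        tauto
      rw [hset]
      refine ih.attach ?_ ?_ ?_
      · rintro U ⟨hU, hUj⟩ (h | ⟨-, h⟩)
        · exact hSN U hU h
        · omega
      · rintro U ⟨hU, hUj⟩ W ⟨hW, hWj⟩ hlt
        exact hρ U hU W hW hlt (hUj.trans hWj.symm)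
      · rintro U ⟨hU, rfl⟩
        exact hlink U hU
  have := key J
  rwa [show {W ∈ N | ρ W < J} = N from Set.sep_eq_self_iff_mem_true.2 hJ] at this

end FlagConeConstructions

end ConeRadius

/-! ### Transversality in intervals of the subspace lattice -/

namespace ConeRadius

section Intervals

variable {K : Type u} {V : Type v} [DivisionRing K] [AddCommGroup V] [Module K V]

/-- Transversality in the interval `[A, B]` of the subspace lattice, i.e. of `U / A` and `E / A`
in `B / A` when `U` and `E` lie in the interval. -/
def RelTransversal (A B U E : Submodule K V) : Prop := U ⊓ E ≤ A ∨ B ≤ U ⊔ E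

/-- The subspaces strictly between `A` and `B` that are transversal, relative to `[A, B]`, to all
members of `L`.  Working with intervals in a fixed space replaces passing to subspaces and
quotients. -/
def transversalInterval (A B : Submodule K V) (L : List (Submodule K V)) :
    Set (Submodule K V) :=
  {U | (A < U ∧ U < B) ∧ ∀ E ∈ L, RelTransversal A B U E}

/-- The weight of a `d`-dimensional member of the family in a space of dimension `n + 2`.  The zero
subspace is transversal to everything and has weight `0`. -/
def weight (n : ℕ) : ℕ → ℕ
  | 0 => 0
  | d + 1 => n.choose d

theorem weight_mono_left {n n' : ℕ} (h : n ≤ n') (d : ℕ) : weight n d ≤ weight n' d := by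
  cases d with
  | zero => exact le_rfl
  | succ d => exact Nat.choose_le_choose d h

theorem weight_eq_zero_of_lt {n d : ℕ} (h : n + 1 < d) : weight n d = 0 := by
  obtain ⟨d, rfl⟩ := Nat.exists_eq_succ_of_ne_zero (by omega : d ≠ 0)
  exact Nat.choose_eq_zero_of_lt (by omega)

theorem one_le_weight {n d : ℕ} (h : d ≠ 0) (h' : d ≤ n + 1) : 1 ≤ weight n d := by
  obtain ⟨d, rfl⟩ := Nat.exists_eq_succ_of_ne_zero h
  exact Nat.choose_pos (by omega)

theorem choose_le_choose_add (p q r : ℕ) : p.choose q ≤ (p + r).choose (q + r) := by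
  induction r with
  | zero => exact le_rfl
  | succ r ih =>
    rw [← add_assoc, ← add_assoc, Nat.choose_succ_succ]
    omega

theorem weight_add_weight_le {n d : ℕ} (hd : d ≠ 0) (r : ℕ) :
    weight n d + weight n (d + 1) ≤ weight (n + 1 + r) (d + 1 + r) := by
  obtain ⟨d, rfl⟩ := Nat.exists_eq_succ_of_ne_zero hd
  have h := choose_le_choose_add (n + 1) (d + 1) r
  rw [Nat.choose_succ_succ] at h
  have e : d.succ + 1 + r = (d + 1 + r) + 1 := by omega
  rw [e]
  exact h

/-- A vector space over `K` is not covered by at most `|K|` proper subspaces. -/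
theorem exists_mem_forall_notMem {B : Submodule K V} {L : List (Submodule K V)}
    (hL : ∀ E ∈ L, ¬ B ≤ E) (hcard : (L.length : ℕ∞) ≤ ENat.card K) :
    ∃ x ∈ B, ∀ E ∈ L, x ∉ E := by
  induction L with
  | nil => exact ⟨0, B.zero_mem, by simp⟩
  | cons E L ih =>
    obtain ⟨x, hxB, hx⟩ := ih (fun E' h => hL E' (by simp [h]))
      (le_trans (by simp) hcard)
    by_cases hxE : x ∈ E
    swap
    · exact ⟨x, hxB, by simpa [hxE] using hx⟩
    obtain ⟨y, hyB, hyE⟩ := SetLike.not_le_iff_exists.1 (hL E (by simp))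
    -- Among the vectors `y + t x` at most one lies in each member of `L`, and none lies in `E`.
    by_contra hcon
    push Not at hcon
    have hbad : ∀ t : K, ∃ i : Fin L.length, y + t • x ∈ L.get i := by
      intro t
      obtain ⟨E', hE', hmem⟩ := hcon (y + t • x) (B.add_mem hyB (B.smul_mem t hxB))
      rcases List.mem_cons.1 hE' with rfl | hE'
      · exact absurd ((Submodule.add_mem_iff_left _ (E'.smul_mem t hxE)).1 hmem) hyE
      · obtain ⟨i, rfl⟩ := List.get_of_mem hE'
        exact ⟨i, hmem⟩
    choose φ hφ using hbad
    have hinj : Function.Injective φ := by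
      intro s t hst
      by_contra hne
      have h1 := hφ s
      rw [hst] at h1
      have h2 := Submodule.sub_mem _ h1 (hφ t)
      rw [add_sub_add_left_eq_sub, ← sub_smul,
        Submodule.smul_mem_iff _ (sub_ne_zero.2 hne)] at h2
      exact hx _ (List.get_mem _ _) h2
    have h1 := ENat.card_le_card_of_injective hinj
    rw [ENat.card_eq_coe_fintype_card (α := Fin L.length), Fintype.card_fin] at h1
    have h2 := hcard.trans h1
    rw [Nat.cast_le, List.length_cons] at h2
    omega

/-- Above `U`, transversality to `E` is transversality to `(E + U) / U` in `B / U`. -/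
theorem relTransversal_above_iff {A B U E W : Submodule K V} (hAU : A ≤ U)
    (hUW : U ≤ W) (h : RelTransversal A B U E) :
    RelTransversal A B W E ↔ RelTransversal U B W (E ⊔ U) := by
  have e1 : W ⊓ (E ⊔ U) = W ⊓ E ⊔ U := (inf_sup_assoc_of_le E hUW).symm
  have e2 : W ⊔ (E ⊔ U) = W ⊔ E := by
    rw [← sup_assoc, sup_eq_left]
    exact hUW.trans le_sup_left
  unfold RelTransversal at h ⊢
  rw [e1, e2]
  constructor
  · exact Or.imp_left fun h1 => sup_le (h1.trans hAU) le_rfl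
  · rintro (h1 | h1)
    · rcases h with h | h
      · exact Or.inl ((le_inf (le_sup_left.trans h1) inf_le_right).trans h)
      · exact Or.inr (h.trans (sup_le_sup_right hUW E))
    · exact Or.inr h1

/-- Below `U`, transversality to `E` is transversality to `E ∩ U` in `U`. -/
theorem relTransversal_below_iff {A B U E W : Submodule K V} (hUB : U ≤ B)
    (hWU : W ≤ U) (h : RelTransversal A B U E) :
    RelTransversal A B W E ↔ RelTransversal A U W (E ⊓ U) := by
  have e1 : W ⊓ (E ⊓ U) = W ⊓ E := by
    rw [← inf_assoc, inf_eq_left]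
    exact inf_le_left.trans hWU
  have e2 : W ⊔ E ⊓ U = (W ⊔ E) ⊓ U := (sup_inf_assoc_of_le E hWU).symm
  unfold RelTransversal at h ⊢
  rw [e1, e2]
  constructor
  · exact Or.imp_right fun h1 => le_inf (hUB.trans h1) le_rfl
  · rintro (h1 | h1)
    · exact Or.inl h1
    · rcases h with h | h
      · exact Or.inl ((inf_le_inf_right E hWU).trans h)
      · exact Or.inr (h.trans (sup_le (h1.trans inf_le_left) le_sup_right))

variable [FiniteDimensional K V]

open Module

theorem finrank_sup_add_inf (s t : Submodule K V) :
    finrank K ↥(s ⊔ t) + finrank K ↥(s ⊓ t) = finrank K s + finrank K t :=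
  Submodule.finrank_sup_add_finrank_inf_eq s t

theorem finrank_inf_of_not_le {A l X : Submodule K V} (hAl : A ≤ l)
    (hl : finrank K l = finrank K A + 1) (hAX : A ≤ X) (h : ¬ l ≤ X) :
    finrank K ↥(X ⊓ l) = finrank K A := by
  have h1 : finrank K A ≤ finrank K ↥(X ⊓ l) := Submodule.finrank_mono (le_inf hAX hAl)
  have h2 : finrank K ↥(X ⊓ l) < finrank K l := Submodule.finrank_lt_finrank_of_lt
    (lt_of_le_of_ne inf_le_right fun he => h (he ▸ inf_le_left))
  omega

theorem finrank_sup_of_not_le {A l X : Submodule K V} (hAl : A ≤ l)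
    (hl : finrank K l = finrank K A + 1) (hAX : A ≤ X) (h : ¬ l ≤ X) :
    finrank K ↥(X ⊔ l) = finrank K X + 1 := by
  have h1 := finrank_inf_of_not_le hAl hl hAX h
  have h2 := finrank_sup_add_inf X l
  omega

/-- Below a subspace `U` that does not contain the line `l` of the interval, transversality of
`W + l` to `E` is transversality of `W` to `(E + l) ∩ U` in `U`. -/
theorem relTransversal_sup_line_iff {A B U E W l : Submodule K V} (hAE : A ≤ E) (hAW : A ≤ W)
    (hWU : W < U) (hUB : U ≤ B) (hAl : A ≤ l) (hl : finrank K l = finrank K A + 1)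
    (hlU : ¬ l ≤ U) (hlE : l ≤ E → E = B) (h : RelTransversal A B U E) :
    RelTransversal A B (W ⊔ l) E ↔ RelTransversal A U W ((E ⊔ l) ⊓ U) := by
  by_cases hlE' : l ≤ E
  · obtain rfl := hlE hlE'
    refine iff_of_true (Or.inr le_sup_right) (Or.inr ?_)
    rw [sup_eq_left.2 hlE', inf_eq_right.2 hUB]
    exact le_sup_right
  have e1 : W ⊓ ((E ⊔ l) ⊓ U) = W ⊓ (E ⊔ l) := by
    rw [← inf_assoc, inf_eq_left]
    exact inf_le_left.trans hWU.le
  have e2 : W ⊔ (E ⊔ l) ⊓ U = (W ⊔ l ⊔ E) ⊓ U := by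
    rw [← sup_inf_assoc_of_le _ hWU.le, sup_comm E l, sup_assoc]
  have hlW : ¬ l ≤ W := fun h => hlU (h.trans hWU.le)
  have d1 := finrank_sup_of_not_le hAl hl hAW hlW
  have d2 := finrank_sup_of_not_le hAl hl hAE hlE'
  have d3 := finrank_sup_add_inf (W ⊔ l) E
  have d4 := finrank_sup_add_inf W (E ⊔ l)
  have e3 : W ⊔ (E ⊔ l) = W ⊔ l ⊔ E := by rw [sup_comm E l, sup_assoc]
  rw [e3] at d4
  have hle : ∀ X : Submodule K V, A ≤ X → (X ≤ A ↔ finrank K X = finrank K A) := fun X hX =>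
    ⟨fun h => by rw [le_antisymm h hX], fun h => (Submodule.eq_of_le_of_finrank_eq hX h.symm).ge⟩
  -- By the dimension formula both intersections have the same dimension.
  have key : (W ⊔ l) ⊓ E ≤ A ↔ W ⊓ (E ⊔ l) ≤ A := by
    rw [hle _ (le_inf (hAW.trans le_sup_left) hAE), hle _ (le_inf hAW (hAE.trans le_sup_left))]
    omega
  unfold RelTransversal
  rw [e1, e2, ← key]
  constructor
  · exact Or.imp_right fun h1 => le_inf (hUB.trans h1) le_rfl
  · rintro (h1 | h1)
    · exact Or.inl h1
    · have hU : U ⊔ E ≤ W ⊔ l ⊔ E := sup_le (h1.trans inf_le_left) le_sup_right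
      rcases h with h | h
      · -- The inclusion `U + E ≤ W + l + E` forces `W`, `l`, `E` to be independent modulo `A`.
        left
        rw [hle _ (le_inf (hAW.trans le_sup_left) hAE)]
        have d5 := finrank_sup_add_inf U E
        have d6 := (hle _ (le_inf (hAW.trans hWU.le) hAE)).1 h
        have d7 := Submodule.finrank_mono hU
        have d8 := Submodule.finrank_lt_finrank_of_lt hWU
        have d9 : finrank K A ≤ finrank K ↥((W ⊔ l) ⊓ E) :=
          Submodule.finrank_mono (le_inf (hAW.trans le_sup_left) hAE)
        omega
      · exact Or.inr (h.trans hU)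

/-- The two members that `E` contributes to the family below `U` weigh at most as much as `E`: this
is Pascal's rule when `E ∩ U ≠ A`, and otherwise only a line can contribute. -/
theorem weight_below_le {A B U E l : Submodule K V} (hAE : A ≤ E) (hEB : E ≤ B) (hAU : A < U)
    (hUB : U < B) (hAl : A ≤ l) (hlB : l ≤ B) (hl : finrank K l = finrank K A + 1)
    (hlU : ¬ l ≤ U) (hlE : l ≤ E → E = B) (h : RelTransversal A B U E) {n n' : ℕ}
    (hn : finrank K B = finrank K A + (n + 2)) (hn' : finrank K U = finrank K A + (n' + 2)) :
    weight n' (finrank K ↥(E ⊓ U) - finrank K A) +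
      weight n' (finrank K ↥((E ⊔ l) ⊓ U) - finrank K A) ≤
    weight n (finrank K E - finrank K A) := by
  have hUB' := Submodule.finrank_lt_finrank_of_lt hUB
  by_cases hEA : E = A
  · subst hEA
    rw [inf_eq_left.2 hAU.le, sup_eq_right.2 hAl, inf_comm,
      finrank_inf_of_not_le hAl hl hAU.le hlU]
    simp [weight]
  by_cases hEB' : E = B
  · subst hEB'
    rw [inf_eq_right.2 hUB.le, inf_eq_right.2 (hUB.le.trans le_sup_left), hn',
      Nat.add_sub_cancel_left, weight_eq_zero_of_lt (by omega)]
    exact Nat.zero_le _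
  have d0 := Submodule.finrank_lt_finrank_of_lt (lt_of_le_of_ne hAE (Ne.symm hEA))
  have d1 := Submodule.finrank_lt_finrank_of_lt (lt_of_le_of_ne hEB hEB')
  have d2 := finrank_sup_of_not_le hAl hl hAE fun h => hEB' (hlE h)
  have d3 := finrank_sup_add_inf E U
  have d4 := finrank_sup_add_inf (E ⊔ l) U
  have d5 : finrank K ↥(E ⊔ U) ≤ finrank K ↥(E ⊔ l ⊔ U) :=
    Submodule.finrank_mono (sup_le_sup_right le_sup_left U)
  have d6 : finrank K A ≤ finrank K ↥(E ⊓ U) := Submodule.finrank_mono (le_inf hAE hAU.le)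
  have d8 : finrank K A ≤ finrank K ↥((E ⊔ l) ⊓ U) :=
    Submodule.finrank_mono (le_inf (hAE.trans le_sup_left) hAU.le)
  by_cases hx : finrank K ↥(E ⊓ U) = finrank K A
  · -- `(E + l) ∩ U` is at most a line and contributes at most `1`.
    have h1 : 1 ≤ weight n (finrank K E - finrank K A) := one_le_weight (by omega) (by omega)
    have h2 : weight n' (finrank K ↥(E ⊓ U) - finrank K A) = 0 := by
      rw [hx, Nat.sub_self, weight]
    have h3 : weight n' (finrank K ↥((E ⊔ l) ⊓ U) - finrank K A) ≤ 1 := by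
      rcases (by omega : finrank K ↥((E ⊔ l) ⊓ U) - finrank K A = 0 ∨
        finrank K ↥((E ⊔ l) ⊓ U) - finrank K A = 1) with h | h <;> simp [h, weight]
    omega
  · have hsup : B ≤ U ⊔ E := h.resolve_left fun h' => hx (by
      rw [inf_comm]
      exact congrArg (fun X : Submodule K V => finrank K X)
        (le_antisymm h' (le_inf hAU.le hAE)))
    have e1 : finrank K B ≤ finrank K ↥(E ⊔ U) := by
      rw [sup_comm]
      exact Submodule.finrank_mono hsup
    have e2 : finrank K ↥(E ⊔ U) ≤ finrank K B := Submodule.finrank_mono (sup_le hEB hUB.le)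
    have e3 : finrank K ↥(E ⊔ l ⊔ U) ≤ finrank K B :=
      Submodule.finrank_mono (sup_le (sup_le hEB hlB) hUB.le)
    have hw := weight_add_weight_le (n := n') (d := finrank K ↥(E ⊓ U) - finrank K A)
      (by omega) (n - n' - 1)
    have a1 : finrank K ↥((E ⊔ l) ⊓ U) - finrank K A =
      finrank K ↥(E ⊓ U) - finrank K A + 1 := by omega
    have a2 : n' + 1 + (n - n' - 1) = n := by omega
    have a3 : finrank K ↥(E ⊓ U) - finrank K A + 1 + (n - n' - 1) =
      finrank K E - finrank K A := by omega
    rw [a2, a3] at hw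
    rw [a1]
    exact hw

/-- The member that `E` contributes to the family above `U` weighs at most as much as `E`. -/
theorem weight_above_le {A B U E : Submodule K V} (hAE : A ≤ E) (hEB : E ≤ B) (hAU : A ≤ U)
    (hUB : U ≤ B) (h : RelTransversal A B U E) {n n' : ℕ}
    (hn : finrank K B = finrank K A + (n + 2)) (hn' : finrank K B = finrank K U + (n' + 2)) :
    weight n' (finrank K ↥(E ⊔ U) - finrank K U) ≤ weight n (finrank K E - finrank K A) := by
  have d1 := Submodule.finrank_mono hAU
  rcases h with h | h
  · have d2 := finrank_sup_add_inf U E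
    rw [le_antisymm h (le_inf hAU hAE), sup_comm] at d2
    rw [show finrank K ↥(E ⊔ U) - finrank K U = finrank K E - finrank K A by omega]
    exact weight_mono_left (by omega) _
  · rw [sup_comm, le_antisymm (sup_le hUB hEB) h, hn', Nat.add_sub_cancel_left,
      weight_eq_zero_of_lt (by omega)]
    exact Nat.zero_le _

theorem length_flag_add_le {A B : Submodule K V} (hAB : A < B) {l : List (Submodule K V)}
    (hl : IsFlag {W | A < W ∧ W < B} l) : finrank K A + l.length + 1 ≤ finrank K B := by
  induction l generalizing A with
  | nil => exact Submodule.finrank_lt_finrank_of_lt hAB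
  | cons x l ih =>
    obtain ⟨h1, h2⟩ := hl.2 x (by simp)
    have := ih h2 ⟨hl.1.of_cons, fun y hy =>
      ⟨List.rel_of_pairwise_cons hl.1 hy, (hl.2 y (by simp [hy])).2⟩⟩
    have := Submodule.finrank_lt_finrank_of_lt h1
    rw [List.length_cons]
    omega

end Intervals

end ConeRadius

/-! ### Cone functions for transversal subspaces -/

namespace ConeRadius

section IntervalCones

variable {K : Type u} {V : Type v} [DivisionRing K] [AddCommGroup V] [Module K V]
  [FiniteDimensional K V]

open Module

/-- The total weight of a family of subspaces of `B / A`, for `dim B / A = n + 2`. -/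
noncomputable def familyWeight (n : ℕ) (A : Submodule K V) (L : List (Submodule K V)) : ℕ :=
  (L.map fun E : Submodule K V => weight n (finrank K E - finrank K A)).sum

/-- A family satisfying the weight bound leaves room for a line of `B / A` that lies in no proper
member. -/
theorem exists_line_avoiding {A B : Submodule K V} {L : List (Submodule K V)} {n : ℕ}
    (hAB' : A ≤ B) (hn : finrank K B = finrank K A + (n + 2)) (hL : ∀ E ∈ L, A ≤ E ∧ E ≤ B)
    (hw : (familyWeight n A L : ℕ∞) ≤ ENat.card K) :
    ∃ l : Submodule K V, A ≤ l ∧ l ≤ B ∧ finrank K l = finrank K A + 1 ∧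
      ∀ E ∈ L, l ≤ E → E = B := by
  classical
  have hAB : ¬ B ≤ A := fun h => by have := Submodule.finrank_mono h; omega
  let L' := L.filter fun E => E ≠ A ∧ E ≠ B
  have hlen : (L'.length : ℕ∞) ≤ ENat.card K := by
    refine le_trans ?_ hw
    rw [Nat.cast_le, familyWeight]
    clear hw
    induction L with
    | nil => simp [L']
    | cons E L ih =>
      have ih' := ih fun E' h => hL E' (by simp [h])
      obtain ⟨h1, h2⟩ := hL E (by simp)
      simp only [L', List.map_cons, List.sum_cons] at ih' ⊢
      by_cases hE : E ≠ A ∧ E ≠ B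
      · rw [List.filter_cons_of_pos (by simpa using hE), List.length_cons]
        have d1 := Submodule.finrank_lt_finrank_of_lt (lt_of_le_of_ne h1 hE.1.symm)
        have d2 := Submodule.finrank_lt_finrank_of_lt (lt_of_le_of_ne h2 hE.2)
        have := one_le_weight (n := n) (d := finrank K E - finrank K A) (by omega) (by omega)
        omega
      · rw [List.filter_cons_of_neg (by simpa using hE)]
        omega
  have hx : ∃ x ∈ B, x ∉ A ∧ ∀ E ∈ L', x ∉ E := by
    have hL' : ∀ E ∈ L', A ≤ E ∧ ¬ B ≤ E := by
      intro E hE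
      obtain ⟨h1, h2⟩ := List.mem_filter.1 hE
      have h3 : E ≠ A ∧ E ≠ B := by simpa using h2
      exact ⟨(hL E h1).1, fun h => h3.2 (le_antisymm (hL E h1).2 h)⟩
    by_cases hnil : L' = []
    · obtain ⟨x, hx, hxA⟩ := SetLike.not_le_iff_exists.1 hAB
      exact ⟨x, hx, hxA, by simp [hnil]⟩
    · obtain ⟨x, hx, hxL⟩ := exists_mem_forall_notMem (fun E hE => (hL' E hE).2) hlen
      obtain ⟨E, hE⟩ := List.exists_mem_of_ne_nil _ hnil
      exact ⟨x, hx, fun h => hxL E hE ((hL' E hE).1 h), hxL⟩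
  obtain ⟨x, hxB, hxA, hxL⟩ := hx
  have hAlt : A ≤ A ⊔ Submodule.span K {x} := le_sup_left
  have hx0 : x ≠ 0 := fun h => hxA (h ▸ A.zero_mem)
  have hmem : x ∈ A ⊔ Submodule.span K {x} :=
    (le_sup_right : _ ≤ A ⊔ Submodule.span K {x}) (Submodule.mem_span_singleton_self x)
  refine ⟨A ⊔ Submodule.span K {x}, le_sup_left,
    sup_le hAB' ((Submodule.span_singleton_le_iff_mem x B).2 hxB), ?_, ?_⟩
  · have d1 := finrank_sup_add_inf A (Submodule.span K {x})
    have d2 := finrank_span_singleton (K := K) hx0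
    have d3 : finrank K A < finrank K ↥(A ⊔ Submodule.span K {x}) :=
      Submodule.finrank_lt_finrank_of_lt (lt_of_le_of_ne hAlt fun h => hxA (h ▸ hmem))
    omega
  · intro E hE hlE
    by_contra hEB
    by_cases hEA : E = A
    · exact hxA (hEA ▸ hlE hmem)
    · exact hxL E (List.mem_filter.2 ⟨hE, by simp [hEA, hEB]⟩) (hlE hmem)

/-- The radius bound obtained from `r` by attaching `N` levels of vertices whose links have radii at
most `R`. -/
def attachBound (R N r : ℕ) : ℕ := (fun r => r + (R * r + R))^[N] r

/-- One step of the induction on dimension.  The complex grows from the star of a line `l` that lies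
in no proper member of the family: first the subspaces `U` for which `U + l` is again a vertex are
attached in increasing dimension, along links with apex `U + l`; then all others in decreasing
dimension, along links that are joins of two complexes of the same kind and smaller dimension. -/
theorem hasCone_transversalInterval_of_lt {A B : Submodule K V} {L : List (Submodule K V)}
    {n N R : ℕ} (hAB : A ≤ B) (hn : finrank K B = finrank K A + (n + 2)) (hnN : n + 2 ≤ N)
    (hL : ∀ E ∈ L, A ≤ E ∧ E ≤ B)
    (hw : (familyWeight n A L : ℕ∞) ≤ ENat.card K)
    (ih : ∀ (A' B' : Submodule K V) (L' : List (Submodule K V)) (n' : ℕ), n' < n + 1 → A' ≤ B' →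
      finrank K B' = finrank K A' + (n' + 1) → (∀ E ∈ L', A' ≤ E ∧ E ≤ B') →
      (∀ n'', n' = n'' + 1 →
        (familyWeight n'' A' L' : ℕ∞) ≤ ENat.card K) →
      HasCone (transversalInterval A' B' L') n' R) :
    HasCone (transversalInterval A B L) (n + 1)
      (attachBound (R + (1 + N * R) * R) N (attachBound 1 N 1)) := by
  obtain ⟨l, hAl, hlB, hl, hlE⟩ := exists_line_avoiding hAB hn hL hw
  set T := transversalInterval A B L with hT
  set Z : Set (Submodule K V) := {U ∈ T | l ≤ U} with hZ
  set M : Set (Submodule K V) := {U ∈ T | U ⊔ l ∈ T ∧ ¬ l ≤ U} with hM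
  set Y : Set (Submodule K V) := {U ∈ T | U ⊔ l ∈ T} with hY
  set X : Set (Submodule K V) := {U ∈ T | U ⊔ l ∉ T} with hX
  have hlT : l ∈ T := by
    refine ⟨⟨lt_of_le_of_ne hAl ?_, lt_of_le_of_ne hlB ?_⟩, fun E hE => ?_⟩
    · rintro rfl
      omega
    · rintro rfl
      omega
    · by_cases h : l ≤ E
      · right
        rw [← hlE E hE h]
        exact le_sup_right
      · left
        have h1 := finrank_inf_of_not_le hAl hl (hL E hE).1 h
        rw [inf_comm]
        exact (Submodule.eq_of_le_of_finrank_eq (le_inf (hL E hE).1 hAl) h1.symm).ge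
  -- The vertices containing `l` form a cone with apex `l`.
  have hZcone : HasCone Z (n + 1) 1 :=
    hasCone_of_comparable (S := Z) (M := l) ⟨hlT, le_rfl⟩
      (fun x hx hne => Or.inr (lt_of_le_of_ne hx.2 hne.symm)) _
  have hYZ : Y = Z ∪ M := by
    ext U
    simp only [hY, hZ, hM, Set.mem_union, Set.mem_sep_iff]
    constructor
    · rintro ⟨h1, h2⟩
      by_cases h : l ≤ U
      · exact Or.inl ⟨h1, h⟩
      · exact Or.inr ⟨h1, h2, h⟩
    · rintro (⟨h1, h2⟩ | ⟨h1, h2, -⟩)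
      · exact ⟨h1, by rwa [sup_eq_left.2 h2]⟩
      · exact ⟨h1, h2⟩
  have hfr : ∀ U ∈ T, finrank K A < finrank K U ∧ finrank K U < finrank K B := fun U hU =>
    ⟨Submodule.finrank_lt_finrank_of_lt hU.1.1, Submodule.finrank_lt_finrank_of_lt hU.1.2⟩
  have hYcone : HasCone Y (n + 1) (attachBound 1 N 1) := by
    rw [hYZ]
    refine hZcone.attach_ranked (fun U hU hUZ => hU.2.2 hUZ.2)
      (fun U => finrank K U - finrank K A) ?_ ?_ N ?_
    · intro U hU W hW hlt
      have := Submodule.finrank_lt_finrank_of_lt hlt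
      have := hfr U hU.1
      have := hfr W hW.1
      omega
    · intro U hU
      have hlt : U < U ⊔ l := lt_of_le_of_ne le_sup_left fun h => hU.2.2 (h ▸ le_sup_right)
      -- `U + l` lies below every vertex of `Z` above `U`, so it is an apex of the link of `U`.
      have hmem : U ⊔ l ∈ Z := ⟨hU.2.1, le_sup_right⟩
      refine hasCone_of_comparable (M := U ⊔ l) (Set.mem_sep (Or.inl hmem) (Or.inr hlt)) ?_ _
      rintro W ⟨hW, hWU | hUW⟩ hne
      · exact Or.inl (hWU.trans hlt)
      · right
        rcases hW with hW | ⟨hW, hρ⟩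
        · exact lt_of_le_of_ne (sup_le hUW.le hW.2) hne.symm
        · have := Submodule.finrank_lt_finrank_of_lt hUW
          have := hfr U hU.1
          have := hfr W hW.1
          omega
    · intro U hU
      have := hfr U hU.1
      omega
  have hTX : T = Y ∪ X := by
    ext U
    simp only [hY, hX, Set.mem_union, Set.mem_sep_iff]
    tauto
  rw [hTX]
  refine hYcone.attach_ranked (fun U hU hUY => hU.2 hUY.2)
    (fun U => finrank K B - finrank K U) ?_ ?_ N ?_
  · intro U hU W hW hlt
    have := Submodule.finrank_lt_finrank_of_lt hlt
    have := hfr U hU.1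
    have := hfr W hW.1
    omega
  swap
  · intro U hU
    have := hfr U hU.1
    omega
  intro U hU
  obtain ⟨⟨⟨hAU, hUB⟩, hUL⟩, hUX⟩ := hU
  have hUT : U ∈ T := ⟨⟨hAU, hUB⟩, hUL⟩
  have hlU : ¬ l ≤ U := fun h => hUX (by rwa [sup_eq_left.2 h])
  obtain ⟨hd1, hd2⟩ := hfr U hUT
  -- The families that describe the link of `U`, below and above `U`.
  set L₁ := L.map (fun E => E ⊓ U) ++ L.map (fun E => (E ⊔ l) ⊓ U) with hL₁
  set L₂ := L.map (fun E => E ⊔ U) with hL₂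
  have hlink : {W ∈ Y ∪ {W ∈ X | finrank K B - finrank K W < finrank K B - finrank K U} |
      W < U ∨ U < W} = transversalInterval A U L₁ ∪ transversalInterval U B L₂ := by
    have hbelow : ∀ W, A < W → W < U → (W ∈ Y ↔ W ∈ transversalInterval A U L₁) := by
      intro W hAW hWU
      have hWl : A < W ⊔ l ∧ W ⊔ l < B := by
        refine ⟨hAW.trans_le le_sup_left,
          lt_of_le_of_ne (sup_le (hWU.le.trans hUB.le) hlB) fun h => ?_⟩
        -- If `W + l = B`, then `U = W + (l ∩ U) = W` by the modular law, as `l` meets `U` in `A`.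
        have h1 : U ⊓ l ≤ W := by
          have := Submodule.eq_of_le_of_finrank_eq (le_inf hAU.le hAl)
            (finrank_inf_of_not_le hAl hl hAU.le hlU).symm
          rw [← this]
          exact hAW.le
        have h2 : U = W ⊔ l ⊓ U := by
          rw [← sup_inf_assoc_of_le l hWU.le, h, inf_eq_right.2 hUB.le]
        rw [inf_comm l U, sup_eq_left.2 h1] at h2
        exact hWU.ne h2.symm
      have hall : (∀ E ∈ L, RelTransversal A B W E ∧ RelTransversal A B (W ⊔ l) E) ↔
          ∀ E ∈ L, RelTransversal A U W (E ⊓ U) ∧ RelTransversal A U W ((E ⊔ l) ⊓ U) :=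
        forall₂_congr fun E hE => and_congr (relTransversal_below_iff hUB.le hWU.le (hUL E hE))
          (relTransversal_sup_line_iff (hL E hE).1 hAW.le hWU hUB.le hAl hl hlU (hlE E hE)
            (hUL E hE))
      constructor
      · rintro ⟨⟨-, h1⟩, -, h2⟩
        have := hall.1 fun E hE => ⟨h1 E hE, h2 E hE⟩
        refine ⟨⟨hAW, hWU⟩, fun F hF => ?_⟩
        rcases List.mem_append.1 hF with hF | hF
        · obtain ⟨E, hE, rfl⟩ := List.mem_map.1 hF
          exact (this E hE).1
        · obtain ⟨E, hE, rfl⟩ := List.mem_map.1 hF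
          exact (this E hE).2
      · rintro ⟨-, h⟩
        have := hall.2 fun E hE =>
          ⟨h _ (List.mem_append_left _ (List.mem_map_of_mem (f := fun E => E ⊓ U) hE)),
            h _ (List.mem_append_right _ (List.mem_map_of_mem (f := fun E => (E ⊔ l) ⊓ U) hE))⟩
        exact ⟨⟨⟨hAW, hWU.trans hUB⟩, fun E hE => (this E hE).1⟩, hWl, fun E hE => (this E hE).2⟩
    have habove : ∀ W, U < W → W < B → (W ∈ T ↔ W ∈ transversalInterval U B L₂) := by
      intro W hUW hWB
      have hall : (∀ E ∈ L, RelTransversal A B W E) ↔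
          ∀ E ∈ L, RelTransversal U B W (E ⊔ U) :=
        forall₂_congr fun E hE => relTransversal_above_iff hAU.le hUW.le (hUL E hE)
      constructor
      · rintro ⟨-, h⟩
        refine ⟨⟨hUW, hWB⟩, fun F hF => ?_⟩
        obtain ⟨E, hE, rfl⟩ := List.mem_map.1 hF
        exact hall.1 h E hE
      · rintro ⟨-, h⟩
        exact ⟨⟨hAU.trans hUW, hWB⟩, hall.2 fun E hE =>
          h _ (List.mem_map_of_mem (f := fun E => E ⊔ U) hE)⟩
    ext W
    constructor
    · rintro ⟨hW, hWU | hUW⟩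
      · rcases hW with hW | ⟨hW, hρ⟩
        · exact Or.inl ((hbelow W hW.1.1.1 hWU).1 hW)
        · have := Submodule.finrank_lt_finrank_of_lt hWU
          omega
      · have hWT : W ∈ T := hW.elim (fun h => h.1) fun h => h.1.1
        exact Or.inr ((habove W hUW hWT.1.2).1 hWT)
    · rintro (hW | hW)
      · exact ⟨Or.inl ((hbelow W hW.1.1 hW.1.2).2 hW), Or.inl hW.1.2⟩
      · have hWT := (habove W hW.1.1 hW.1.2).2 hW
        refine ⟨?_, Or.inr hW.1.1⟩
        by_cases h : W ⊔ l ∈ T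
        · exact Or.inl ⟨hWT, h⟩
        · refine Or.inr ⟨⟨hWT, h⟩, ?_⟩
          have := Submodule.finrank_lt_finrank_of_lt hW.1.1
          have := hfr W hWT
          omega
  obtain ⟨i, hi⟩ : ∃ i, finrank K U = finrank K A + (i + 1) :=
    ⟨finrank K U - finrank K A - 1, by omega⟩
  obtain ⟨j, hj⟩ : ∃ j, finrank K B = finrank K U + (j + 1) :=
    ⟨finrank K B - finrank K U - 1, by omega⟩
  have hc₁ : HasCone (transversalInterval A U L₁) i R := by
    refine ih A U L₁ i (by omega) hAU.le hi (fun F hF => ?_) fun n' hn' => le_trans ?_ hw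
    · rcases List.mem_append.1 hF with hF | hF
      · obtain ⟨E, hE, rfl⟩ := List.mem_map.1 hF
        exact ⟨le_inf (hL E hE).1 hAU.le, inf_le_right⟩
      · obtain ⟨E, hE, rfl⟩ := List.mem_map.1 hF
        exact ⟨le_inf ((hL E hE).1.trans le_sup_left) hAU.le, inf_le_right⟩
    · rw [Nat.cast_le, familyWeight, familyWeight, hL₁, List.map_append, List.sum_append,
        List.map_map, List.map_map, ← List.sum_map_add]
      refine List.sum_le_sum fun E hE => ?_
      exact weight_below_le (hL E hE).1 (hL E hE).2 hAU hUB hAl hlB hl hlU (hlE E hE) (hUL E hE)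
        hn (by omega)
  have hc₂ : HasCone (transversalInterval U B L₂) j R := by
    refine ih U B L₂ j (by omega) hUB.le hj (fun F hF => ?_) fun n' hn' => le_trans ?_ hw
    · obtain ⟨E, hE, rfl⟩ := List.mem_map.1 hF
      exact ⟨le_sup_right, sup_le (hL E hE).2 hUB.le⟩
    · rw [Nat.cast_le, familyWeight, familyWeight, hL₂, List.map_map]
      refine List.sum_le_sum fun E hE => ?_
      exact weight_above_le (hL E hE).1 (hL E hE).2 hAU.le hUB.le (hUL E hE) hn (by omega)
  rw [hlink]
  have hjoin := hc₁.join (fun W hW W' hW' => hW.1.2.trans hW'.1.1) (fun F hF => ?_) hc₂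
  · rw [show n + 1 - 1 = i + j by omega]
    refine hjoin.mono ?_
    gcongr
    omega
  · have := length_flag_add_le hAU (hF.mono fun W hW => hW.1)
    omega

/-- The radius bound for intervals of dimension at most `N`. -/
def intervalBound : ℕ → ℕ
  | 0 => 0
  | N + 1 => attachBound (intervalBound N + (1 + (N + 1) * intervalBound N) * intervalBound N)
      (N + 1) (attachBound 1 (N + 1) 1) + intervalBound N

theorem hasCone_transversalInterval (N : ℕ) :
    ∀ (A B : Submodule K V) (L : List (Submodule K V)) (n : ℕ), n < N → A ≤ B →
      finrank K B = finrank K A + (n + 1) → (∀ E ∈ L, A ≤ E ∧ E ≤ B) →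
      (∀ n', n = n' + 1 →
        (familyWeight n' A L : ℕ∞) ≤ ENat.card K) →
      HasCone (transversalInterval A B L) n (intervalBound N) := by
  induction N with
  | zero => intro A B L n h; exact absurd h (Nat.not_lt_zero n)
  | succ N ih =>
    intro A B L n hnN hAB hn hL hw
    cases n with
    | zero => exact hasCone_zero _ _
    | succ n =>
      refine (hasCone_transversalInterval_of_lt (N := N + 1) (R := intervalBound N) hAB hn
        (by omega) hL (hw n rfl) fun A' B' L' n' hn' => ih A' B' L' n' (by omega)).mono ?_
      exact Nat.le_add_right _ _

end IntervalCones

end ConeRadius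

/-! ### From list chains to oriented chains -/

namespace ConeRadius

section Transport

open ListChain

variable {α : Type*} [PartialOrder α] {S : Set α}

/-- The flag complex of a set of elements of a poset. -/
abbrev orderComplex (S : Set α) : PreAbstractSimplicialComplex α :=
  flagComplex S fun a b => a ≤ b ∨ b ≤ a

theorem isOrdered_orderComplex_iff {p : ℕ} {v : Fin p → α} :
    IsOrdered (orderComplex S) v ↔
      Function.Injective v ∧ (∀ i, v i ∈ S) ∧ ∀ i j, v i ≤ v j ∨ v j ≤ v i := by
  constructor
  · rintro ⟨hv, h | ⟨-, h1, h2⟩⟩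
    · have hp : IsEmpty (Fin p) := by
        rwa [Finset.map_eq_empty, Finset.univ_eq_empty_iff] at h
      exact ⟨hv, fun i => hp.elim i, fun i => hp.elim i⟩
    · exact ⟨hv, fun i => h1 _ (by simp), fun i j => h2 _ (by simp) _ (by simp)⟩
  · rintro ⟨hv, h1, h2⟩
    refine ⟨hv, ?_⟩
    rcases Nat.eq_zero_or_pos p with rfl | hp
    · exact Or.inl (by simp)
    · refine Or.inr ⟨⟨v ⟨0, hp⟩, by simp⟩, ?_, ?_⟩
      · intro a ha
        obtain ⟨i, -, rfl⟩ := Finset.mem_map.1 ha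
        exact h1 i
      · intro a ha b hb
        obtain ⟨i, -, rfl⟩ := Finset.mem_map.1 ha
        obtain ⟨j, -, rfl⟩ := Finset.mem_map.1 hb
        exact h2 i j

theorem isFlag_ofFn_iff {p : ℕ} {v : Fin p → α} :
    IsFlag S (List.ofFn v) ↔ StrictMono v ∧ ∀ i, v i ∈ S := by
  simp only [IsFlag, List.pairwise_ofFn, List.mem_ofFn, forall_exists_index,
    forall_apply_eq_imp_iff]
  rfl

theorem isOrdered_of_isFlag {p : ℕ} {v : Fin p → α} (h : IsFlag S (List.ofFn v)) :
    IsOrdered (orderComplex S) v := by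
  obtain ⟨h1, h2⟩ := isFlag_ofFn_iff.1 h
  exact isOrdered_orderComplex_iff.2 ⟨h1.injective, h2, fun i j =>
    (le_total i j).imp (fun h => h1.monotone h) fun h => h1.monotone h⟩

theorem isFlag_of_isOrdered {p : ℕ} {v : Fin p → α} (h : IsOrdered (orderComplex S) v)
    (hv : StrictMono v) : IsFlag S (List.ofFn v) :=
  isFlag_ofFn_iff.2 ⟨hv, (isOrdered_orderComplex_iff.1 h).2.1⟩

theorem IsOrdered.exists_strictMono {p : ℕ} {v : Fin p → α} (h : IsOrdered (orderComplex S) v) :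
    ∃ γ : Equiv.Perm (Fin p), StrictMono (v ∘ γ) := by
  classical
  obtain ⟨hv, -, hc⟩ := isOrdered_orderComplex_iff.1 h
  -- Sort by the number of smaller vertices.
  let f : Fin p → ℕ := fun i => (Finset.univ.filter fun j => v j < v i).card
  have hf : ∀ i j, v i < v j → f i < f j := fun i j hij => Finset.card_lt_card <| by
    refine Finset.ssubset_iff_of_subset (fun k hk => ?_) |>.2 ⟨i, by simpa using hij, by simp⟩
    simp only [Finset.mem_filter_univ] at hk ⊢
    exact hk.trans hij
  refine ⟨Tuple.sort f, fun a b hab => ?_⟩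
  have hmono : f (Tuple.sort f a) ≤ f (Tuple.sort f b) := Tuple.monotone_sort f hab.le
  have hne : v (Tuple.sort f a) ≠ v (Tuple.sort f b) := fun h =>
    hab.ne ((Tuple.sort f).injective (hv h))
  rcases hc (Tuple.sort f a) (Tuple.sort f b) with h | h
  · exact lt_of_le_of_ne h hne
  · exact absurd (hf _ _ (lt_of_le_of_ne h hne.symm)) (not_lt.2 hmono)

theorem perm_eq_one_of_strictMono_comp {p : ℕ} {v : Fin p → α} (hv : StrictMono v)
    {γ : Equiv.Perm (Fin p)} (h : StrictMono (v ∘ γ)) : γ = 1 := by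
  have hγ : StrictMono γ := by
    intro a b hab
    rcases lt_trichotomy (γ a) (γ b) with h1 | h1 | h1
    · exact h1
    · exact absurd (γ.injective h1) hab.ne
    · exact absurd ((h hab).trans (hv h1)) (lt_irrefl _)
  ext x
  have := congrArg (fun e => e x) (Subsingleton.elim
    (hγ.orderIsoOfSurjective γ γ.surjective) (OrderIso.refl (Fin p)))
  exact congrArg Fin.val this

/-- The ordered simplex given by an increasing flag. -/
def flagSimplex {p : ℕ} {v : Fin p → α} (h : IsFlag S (List.ofFn v)) :
    OrderedSimplex (orderComplex S) p :=
  ⟨v, isOrdered_of_isFlag h⟩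

open Classical in
/-- From list chains to oriented chains: a flag is sent to its elementary chain, oriented by the
increasing order, and every other list to zero. -/
noncomputable def toChains (S : Set α) (p : ℕ) :
    ListChain α →ₗ[ℤ] chains (orderComplex S) p :=
  Finsupp.linearCombination ℤ fun l =>
    if h : ∃ v : Fin p → α, l = List.ofFn v ∧ IsFlag S (List.ofFn v) then
      elementary (flagSimplex h.choose_spec.2)
    else 0

theorem toChains_single {p : ℕ} {v : Fin p → α} (h : IsFlag S (List.ofFn v)) :
    toChains S p (.single (List.ofFn v) 1) = elementary (flagSimplex h) := by
  have hex : ∃ w : Fin p → α, List.ofFn v = List.ofFn w ∧ IsFlag S (List.ofFn w) := ⟨v, rfl, h⟩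
  have hc : hex.choose = v := List.ofFn_injective hex.choose_spec.1.symm
  rw [toChains, Finsupp.linearCombination_single, one_smul, dif_pos hex]
  congr 1
  exact Subtype.ext hc

open Classical in
/-- From oriented chains to list chains: record the coefficients of the increasing orderings. -/
noncomputable def ofChains (S : Set α) (p : ℕ) :
    chains (orderComplex S) p →ₗ[ℤ] ListChain α :=
  (Finsupp.linearCombination ℤ fun v : Fin p → α =>
    if StrictMono v then (.single (List.ofFn v) 1 : ListChain α) else 0).comp
      (chains (orderComplex S) p).subtype

theorem ofChains_mem {p : ℕ} (t : chains (orderComplex S) p) :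
    ofChains S p t ∈ flagChains S p := by
  rw [ofChains, LinearMap.comp_apply, Finsupp.linearCombination_apply]
  refine Submodule.sum_mem _ fun v hv => Submodule.smul_mem _ _ ?_
  split_ifs with h
  · exact single_mem_flagChains
      (isFlag_of_isOrdered (t.2.1 v (Finsupp.mem_support_iff.1 hv)) h) (by simp)
  · exact Submodule.zero_mem _

theorem ofChains_apply {p : ℕ} (t : chains (orderComplex S) p) {v : Fin p → α}
    (hv : StrictMono v) : ofChains S p t (List.ofFn v) = (t : (Fin p → α) →₀ ℤ) v := by
  classical
  rw [ofChains, LinearMap.comp_apply, Finsupp.linearCombination_apply, Finsupp.sum,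
    Finsupp.finsetSum_apply]
  rw [Finset.sum_eq_single v]
  · simp [hv]
  · intro w _ hne
    have : List.ofFn w ≠ List.ofFn v := fun h => hne (List.ofFn_injective h)
    split_ifs <;> simp [this]
  · intro h
    simpa [hv] using h

theorem ofChains_injective {p : ℕ} : Function.Injective (ofChains S p) := by
  rw [injective_iff_map_eq_zero]
  intro t ht
  ext v
  by_contra hne
  obtain ⟨γ, hγ⟩ := (t.2.1 v hne).exists_strictMono
  have h := ofChains_apply t hγ
  rw [ht, t.2.2 γ v] at h
  exact hne (by simpa using h.symm)

theorem ofChains_elementary {p : ℕ} (σ : OrderedSimplex (orderComplex S) p)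
    {γ : Equiv.Perm (Fin p)} (h : StrictMono (σ.1 ∘ γ)) :
    ofChains S p (elementary σ) =
      (Equiv.Perm.sign γ : ℤ) • .single (List.ofFn (σ.1 ∘ γ)) 1 := by
  classical
  rw [ofChains, LinearMap.comp_apply, Submodule.subtype_apply, elementary, map_sum,
    Finset.sum_eq_single γ]
  · rw [Finsupp.linearCombination_single, if_pos h]
  · intro δ _ hne
    rw [Finsupp.linearCombination_single, if_neg, smul_zero]
    intro hδ
    refine hne ?_
    have : (σ.1 ∘ γ) ∘ ⇑(γ⁻¹ * δ) = σ.1 ∘ δ := by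
      funext x
      simp
    rw [← this] at hδ
    exact (inv_mul_eq_one.1 (perm_eq_one_of_strictMono_comp h hδ)).symm
  · simp

theorem ofChains_toChains {p : ℕ} {x : ListChain α} (hx : x ∈ flagChains S p) :
    ofChains S p (toChains S p x) = x := by
  refine eq_of_mem_supported (f := (ofChains S p).comp (toChains S p)) (g := LinearMap.id)
    (fun l hl => ?_) hx
  obtain ⟨v, rfl⟩ := exists_ofFn hl.2
  have h : StrictMono ((flagSimplex hl.1).1 ∘ (1 : Equiv.Perm (Fin p))) :=
    (isFlag_ofFn_iff.1 hl.1).1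
  rw [LinearMap.comp_apply, toChains_single hl.1, ofChains_elementary _ h]
  simp [flagSimplex]

theorem toChains_ofChains {p : ℕ} (t : chains (orderComplex S) p) :
    toChains S p (ofChains S p t) = t :=
  ofChains_injective (ofChains_toChains (ofChains_mem t))

theorem boundary_toChains {p : ℕ} {x : ListChain α} (hx : x ∈ flagChains S (p + 1)) :
    boundary (orderComplex S) p (toChains S (p + 1) x) = toChains S p (d x) := by
  refine eq_of_mem_supported (f := (boundary (orderComplex S) p).comp (toChains S (p + 1)))
    (g := (toChains S p).comp d) (fun l hl => ?_) hx
  obtain ⟨v, rfl⟩ := exists_ofFn hl.2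
  rw [LinearMap.comp_apply, LinearMap.comp_apply, toChains_single hl.1, boundary_elementary,
    d_single_ofFn, map_sum]
  refine Finset.sum_congr rfl fun i _ => ?_
  obtain ⟨h1, h2⟩ := isFlag_ofFn_iff.1 hl.1
  have hi : IsFlag S (List.ofFn (v ∘ i.succAbove)) :=
    isFlag_ofFn_iff.2 ⟨h1.comp (Fin.strictMono_succAbove i), fun j => h2 _⟩
  rw [map_smul, toChains_single hi]
  rfl

theorem ofChains_boundary {p : ℕ} (t : chains (orderComplex S) (p + 1)) :
    ofChains S p (boundary (orderComplex S) p t) = d (ofChains S (p + 1) t) := by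
  conv_lhs => rw [← toChains_ofChains t, boundary_toChains (ofChains_mem t)]
  exact ofChains_toChains (d_mem_flagChains (ofChains_mem t))

theorem card_supp_toChains_le {p : ℕ} (x : ListChain α) :
    (supp (toChains S p x)).card ≤ size x := by
  classical
  refine le_trans (Finset.card_le_card (t := x.support.image List.toFinset) fun s hs => ?_)
    Finset.card_image_le
  obtain ⟨w, hw, rfl⟩ := Finset.mem_image.1 hs
  rw [Finsupp.mem_support_iff, toChains, Finsupp.linearCombination_apply, Finsupp.sum,
    AddSubmonoidClass.coe_finsetSum, Finsupp.finsetSum_apply] at hw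
  obtain ⟨l, hl, hne⟩ := Finset.exists_ne_zero_of_sum_ne_zero hw
  refine Finset.mem_image.2 ⟨l, hl, ?_⟩
  split_ifs at hne with h
  · rw [Submodule.coe_smul, Finsupp.smul_apply] at hne
    have hne' := right_ne_zero_of_smul hne
    obtain ⟨γ, hw'⟩ := exists_perm_of_elementary_ne_zero _ hne'
    change h.choose ∘ γ = w at hw'
    conv_lhs => rw [h.choose_spec.1]
    ext a
    rw [← hw']
    simp only [List.mem_toFinset, List.mem_ofFn, Finset.mem_image, Finset.mem_univ,
      true_and, Function.comp_apply]
    exact ⟨fun ⟨i, hi⟩ => ⟨γ.symm i, by simpa using hi⟩, fun ⟨i, hi⟩ => ⟨γ i, hi⟩⟩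
  · simp at hne

/-- A cone function on the flags of `S` with at most `m` elements is an `(m - 1)`-cone function on
the flag complex of `S`, with the same radii. -/
theorem HasCone.exists_coneFunction {m R : ℕ} (h : HasCone S (m + 1) R) :
    ∃ C : ConeFunction (orderComplex S) m, ∀ (p : ℕ) (hp : p ≤ m), C.radius p hp ≤ (R : ℕ∞) := by
  obtain ⟨k, hk⟩ := h
  obtain ⟨v, hv⟩ := hk.apex (Nat.succ_pos m)
  have hmem : ∀ {p : ℕ}, p ≤ m → ∀ {x : ListChain α}, x ∈ flagChains S p →
      k x ∈ flagChains S (p + 1) := by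
    intro p hp x hx
    refine map_mem_of_mem_supported (f := k) (fun l hl => ?_) hx
    have h := hk.mem l hl.1 (by have := hl.2; omega)
    rwa [hl.2] at h
  have hvlist : [v] = List.ofFn fun _ : Fin 1 => v := by simp
  have hflag : IsFlag S [v] := by
    have h := hmem (Nat.zero_le m) (single_mem_flagChains IsFlag.nil rfl)
    rw [hv] at h
    have h' : ([v] : List α) ∈ {l | IsFlag S l ∧ l.length = 1} :=
      h (by simp [Finsupp.support_single])
    exact h'.1
  have hface : {v} ∈ (orderComplex S).faces := by
    refine ⟨Finset.singleton_nonempty v, ?_, ?_⟩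
    · simpa using hflag.2
    · simp
  refine ⟨⟨v, hface, fun p _ => (toChains S (p + 1)).comp (k.comp (ofChains S p)), ?_, ?_⟩, ?_⟩
  · intro a
    have h0 : ofChains S 0 (elementary (emptySimplex (orderComplex S))) = .single [] 1 := by
      rw [ofChains_elementary _ (γ := 1) (fun i => i.elim0)]
      simp
    rw [hvlist] at hflag hv
    rw [map_smul, LinearMap.comp_apply, LinearMap.comp_apply, h0, hv, toChains_single hflag]
    rfl
  · intro p hp A
    have hA := ofChains_mem A
    simp only [LinearMap.comp_apply]
    rw [boundary_toChains (hmem hp hA), ofChains_boundary, ← map_add]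
    have : d (k (ofChains S (p + 1) A)) + k (d (ofChains S (p + 1) A)) =
        ofChains S (p + 1) A := by
      rw [hk.d_apply (mem_supported_of_forall hA fun l hl => ⟨hl.1, by have := hl.2; omega⟩)]
      abel
    rw [this, toChains_ofChains]
  · intro p hp
    refine iSup_le fun σ => iSup_le fun a => ?_
    rw [Nat.cast_le]
    refine (card_supp_toChains_le _).trans ?_
    obtain ⟨γ, hγ⟩ := σ.2.exists_strictMono
    have hfl : IsFlag S (List.ofFn (σ.1 ∘ γ)) :=
      isFlag_of_isOrdered (σ.2.comp γ γ.injective) hγ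
    rw [LinearMap.comp_apply, map_smul, map_smul, ofChains_elementary σ hγ, map_smul]
    refine (size_smul _ _).trans ((size_smul _ _).trans (hk.size_le _ hfl ?_))
    rw [List.length_ofFn]
    omega

end Transport

end ConeRadius

/-! ### Opposition is transversality -/

namespace ConeRadius

section Opposition

open Module

/-- Two flags that are pairwise transversal are, after adding `0` and `V`, spanned by initial and by
final segments of a common basis.  The first basis vector is taken from the smallest nonzero member
of the first flag, outside the largest proper member `B` of the second; the others come from a
hyperplane that contains `B`. -/
theorem exists_basis_of_transversal (K : Type u) [DivisionRing K] (N : ℕ) :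
    ∀ (V : Type v) [AddCommGroup V] [Module K V] [FiniteDimensional K V], finrank K V = N →
      ∀ P Q : Set (Submodule K V), IsChain (· ≤ ·) P → IsChain (· ≤ ·) Q → ⊤ ∈ P → ⊥ ∈ Q →
        (∀ U ∈ P, ∀ W ∈ Q, Transversal U W) →
        ∃ b : Basis (Fin N) K V,
          (∀ U ∈ P, ∃ i : ℕ, U = Submodule.span K (b '' {j | (j : ℕ) < i})) ∧
          ∀ W ∈ Q, ∃ i : ℕ, W = Submodule.span K (b '' {j | i ≤ (j : ℕ)}) := by
  induction N with
  | zero =>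
    intro V _ _ _ hV P Q _ _ _ _ _
    have : Subsingleton V := finrank_zero_iff.1 hV
    exact ⟨finBasisOfFinrankEq K V hV, fun U _ => ⟨0, Subsingleton.elim _ _⟩,
      fun W _ => ⟨0, Subsingleton.elim _ _⟩⟩
  | succ N ih =>
    intro V _ _ _ hV P Q hP hQ hPtop hQbot hPQ
    have hnt : Nontrivial V := nontrivial_of_finrank_pos (R := K) (by omega)
    obtain ⟨A, ⟨hAP, hA0⟩, hAmin⟩ := exists_minimal_of_wellFoundedLT
      (fun U => U ∈ P ∧ U ≠ ⊥) ⟨⊤, hPtop, top_ne_bot⟩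
    obtain ⟨B, ⟨hBQ, hB1⟩, hBmax⟩ := exists_maximal_of_wellFoundedGT
      (fun W => W ∈ Q ∧ W ≠ ⊤) ⟨⊥, hQbot, bot_ne_top⟩
    have hAle : ∀ U ∈ P, U ≠ ⊥ → A ≤ U := fun U hU hU0 =>
      (hP.total hAP hU).elim id fun h => hAmin ⟨hU, hU0⟩ h
    have hleB : ∀ W ∈ Q, W ≠ ⊤ → W ≤ B := fun W hW hW1 =>
      (hQ.total hBQ hW).elim (fun h => hBmax ⟨hW, hW1⟩ h) id
    have hAB : ¬ A ≤ B := by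
      intro h
      rcases hPQ A hAP B hBQ with h' | h'
      · exact hA0 (by rwa [inf_eq_left.2 h] at h')
      · exact hB1 (by rwa [sup_eq_right.2 h] at h')
    obtain ⟨x, hxA, hxB⟩ := SetLike.not_le_iff_exists.1 hAB
    have hx0 : x ≠ 0 := fun h => hxB (h ▸ B.zero_mem)
    obtain ⟨H, hBH, hH⟩ := Disjoint.exists_isCompl
      (((Submodule.disjoint_span_singleton' hx0).2 hxB))
    have hHN : finrank K H = N := by
      have h1 := Submodule.finrank_add_eq_of_isCompl hH
      rw [finrank_span_singleton hx0] at h1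
      omega
    have hxH : x ∉ H := fun h =>
      (Submodule.disjoint_span_singleton' hx0).1 hH.disjoint h
    have hWH : ∀ W ∈ Q, W ≠ ⊤ → W ≤ H := fun W hW hW1 => (hleB W hW hW1).trans hBH
    obtain ⟨b, hb1, hb2⟩ := ih H hHN (Submodule.comap H.subtype '' P)
      (Submodule.comap H.subtype '' Q)
      (hP.image_of_map_rel _ _ _ fun _ _ h => Submodule.comap_mono h)
      (hQ.image_of_map_rel _ _ _ fun _ _ h => Submodule.comap_mono h)
      ⟨⊤, hPtop, Submodule.comap_top _⟩ ⟨⊥, hQbot, by simp⟩ (by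
        rintro _ ⟨U, hU, rfl⟩ _ ⟨W, hW, rfl⟩
        by_cases hW1 : W = ⊤
        · right
          rw [hW1, Submodule.comap_top, sup_top_eq]
        rcases hPQ U hU W hW with h | h
        · left
          rw [← Submodule.comap_inf, h]
          simp
        · right
          rw [eq_top_iff]
          rintro ⟨y, hy⟩ -
          obtain ⟨u, hu, w, hw, huw⟩ := Submodule.mem_sup.1 (h ▸ Submodule.mem_top (x := y))
          have hwH := hWH W hW hW1 hw
          have huH : u ∈ H := by
            rw [← add_sub_cancel_right u w, huw]
            exact H.sub_mem hy hwH
          exact Submodule.mem_sup.2 ⟨⟨u, huH⟩, hu, ⟨w, hwH⟩, hw, Subtype.ext huw⟩)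
    let b' : Basis (Fin (N + 1)) K V := Basis.mkFinCons x b
      (fun c y hy h => by
        by_contra hc
        refine hxH ((Submodule.smul_mem_iff H hc).1 ?_)
        rw [eq_neg_of_add_eq_zero_left h]
        exact H.neg_mem hy)
      (fun z => by
        obtain ⟨h, hh, y, hy, rfl⟩ := Submodule.mem_sup.1
          (hH.sup_eq_top ▸ Submodule.mem_top (x := z))
        obtain ⟨c, rfl⟩ := Submodule.mem_span_singleton.1 hy
        exact ⟨-c, by simpa using hh⟩)
    have hb'0 : b' 0 = x := by simp [b']
    have hb's : ∀ i, b' (Fin.succ i) = (b i : V) := fun i => by simp [b']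
    -- The span of a set of basis vectors of `H`, seen in `V`.
    have hmap : ∀ s : Set (Fin N), (Submodule.span K (b '' s)).map H.subtype =
        Submodule.span K (b' '' (Fin.succ '' s)) := by
      intro s
      rw [Submodule.map_span, Set.image_image, Set.image_image]
      congr 1
      exact Set.image_congr fun i _ => (hb's i).symm
    refine ⟨b', fun U hU => ?_, fun W hW => ?_⟩
    · by_cases hU0 : U = ⊥
      · exact ⟨0, by simp [hU0]⟩
      obtain ⟨i, hi⟩ := hb1 _ ⟨U, hU, rfl⟩
      refine ⟨i + 1, ?_⟩
      have hxU : x ∈ U := hAle U hU hU0 hxA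
      have h1 : H ⊓ U = Submodule.span K (b' '' (Fin.succ '' {j | (j : ℕ) < i})) := by
        rw [← hmap, ← hi, Submodule.map_comap_subtype]
      have h2 : U = Submodule.span K {x} ⊔ H ⊓ U := by
        rw [← sup_inf_assoc_of_le H ((Submodule.span_singleton_le_iff_mem x U).2 hxU), sup_comm,
          hH.sup_eq_top, top_inf_eq]
      have h3 : {j : Fin (N + 1) | (j : ℕ) < i + 1} =
          insert 0 (Fin.succ '' {j : Fin N | (j : ℕ) < i}) := by
        ext j
        refine Fin.cases ?_ (fun j => ?_) j <;> simp [Fin.succ_ne_zero]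
      rw [h3, Set.image_insert_eq, Submodule.span_insert, hb'0, ← h1]
      exact h2
    · by_cases hW1 : W = ⊤
      · refine ⟨0, ?_⟩
        rw [hW1]
        simp [b'.span_eq]
      obtain ⟨i, hi⟩ := hb2 _ ⟨W, hW, rfl⟩
      refine ⟨i + 1, ?_⟩
      have h1 : W = (W.comap H.subtype).map H.subtype := by
        rw [Submodule.map_comap_subtype, inf_eq_right.2 (hWH W hW hW1)]
      have h3 : {j : Fin (N + 1) | i + 1 ≤ (j : ℕ)} = Fin.succ '' {j : Fin N | i ≤ (j : ℕ)} := by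
        ext j
        refine Fin.cases ?_ (fun j => ?_) j <;> simp [Fin.succ_ne_zero]
      rw [h3, ← hmap, ← hi]
      exact h1

variable {K : Type u} {V : Type v} [DivisionRing K] [AddCommGroup V] [Module K V]

theorem transversal_span_segments {N : ℕ} (b : Basis (Fin N) K V) (i k : ℕ) :
    Transversal (Submodule.span K (b '' {j | (j : ℕ) < i}))
      (Submodule.span K (b '' {j | k ≤ (j : ℕ)})) := by
  rcases le_total i k with h | h
  · left
    rw [← disjoint_iff]
    refine b.linearIndependent.disjoint_span_image (Set.disjoint_left.2 fun j h1 h2 => ?_)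
    have h1' : (j : ℕ) < i := h1
    have h2' : k ≤ (j : ℕ) := h2
    omega
  · right
    rw [← Submodule.span_union, ← Set.image_union, eq_top_iff, ← b.span_eq]
    refine Submodule.span_mono ?_
    rintro _ ⟨j, rfl⟩
    refine Set.mem_image_of_mem b ?_
    rcases lt_or_ge (j : ℕ) i with h1 | h1
    · exact Or.inl h1
    · exact Or.inr (h.trans h1)

theorem reindex_rev_image {N : ℕ} (b : Basis (Fin N) K V) {i : ℕ} (hi : i ≤ N) :
    b.reindex Fin.revPerm '' {j | (j : ℕ) < i} = b '' {j | N - i ≤ (j : ℕ)} := by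
  ext y
  constructor
  · rintro ⟨j, hj, rfl⟩
    have hj' : (j : ℕ) < i := hj
    refine ⟨j.rev, ?_, by simp⟩
    change N - i ≤ (j.rev : ℕ)
    rw [Fin.val_rev]
    omega
  · rintro ⟨j, hj, rfl⟩
    have hj' : N - i ≤ (j : ℕ) := hj
    refine ⟨j.rev, ?_, by simp⟩
    change (j.rev : ℕ) < i
    rw [Fin.val_rev]
    omega

/-- The complex opposite a simplex `a` of the building is the complex of the subspaces transversal
to all vertices of `a`. -/
theorem oppositionComplex_eq [FiniteDimensional K V] {a : Finset (Submodule K V)}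
    (ha : a ∈ simplices (building K V)) :
    oppositionComplex a = transversalComplex (a : Set (Submodule K V)) := by
  classical
  have ha' : (∀ W ∈ a, W ≠ ⊥ ∧ W ≠ ⊤) ∧ ∀ W ∈ a, ∀ W' ∈ a, Incident W W' := by
    rcases ha with rfl | ⟨-, h1, h2⟩
    · simp
    · exact ⟨h1, h2⟩
  apply PreAbstractSimplicialComplex.ext
  ext τ
  constructor
  · rintro ⟨⟨hne, h1, h2⟩, c, d, ⟨b, rfl, rfl⟩, hc, hd⟩
    refine ⟨hne, fun U hU => ⟨h1 U hU, fun W hW => ?_⟩, h2⟩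
    obtain ⟨i, -, rfl⟩ := Finset.mem_image.1 (hc hU)
    obtain ⟨k, hk, rfl⟩ := Finset.mem_image.1 (hd hW)
    rw [reindex_rev_image b (Finset.mem_Ioo.1 hk).2.le]
    exact transversal_span_segments b _ _
  · rintro ⟨hne, h1, h2⟩
    refine ⟨⟨hne, fun U hU => (h1 U hU).1, h2⟩, ?_⟩
    obtain ⟨b, hb1, hb2⟩ := exists_basis_of_transversal K _ V rfl
      (insert ⊤ (τ : Set (Submodule K V))) (insert ⊥ (a : Set (Submodule K V)))
      (IsChain.insert (fun U hU W hW _ => h2 U hU W hW) fun U _ _ => Or.inr le_top)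
      (IsChain.insert (fun U hU W hW _ => ha'.2 U hU W hW) fun U _ _ => Or.inl bot_le)
      (Set.mem_insert _ _) (Set.mem_insert _ _) (by
        rintro U (rfl | hU) W (rfl | hW)
        · exact Or.inl (inf_bot_eq _)
        · exact Or.inr (top_sup_eq _)
        · exact Or.inl (inf_bot_eq _)
        · exact (h1 U hU).2 W hW)
    refine ⟨_, _, ⟨b, rfl, rfl⟩, fun U hU => ?_, fun W hW => ?_⟩
    · obtain ⟨i, hi⟩ := hb1 U (Set.mem_insert_of_mem _ hU)
      refine Finset.mem_image.2 ⟨i, Finset.mem_Ioo.2 ⟨?_, ?_⟩, hi.symm⟩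
      · rw [Nat.pos_iff_ne_zero]
        rintro rfl
        exact (h1 U hU).1.1 (by simpa using hi)
      · by_contra hcon
        refine (h1 U hU).1.2 ?_
        rw [hi, show {j : Fin (finrank K V) | (j : ℕ) < i} = Set.univ from
          Set.eq_univ_of_forall fun j => by
            change (j : ℕ) < i
            omega, Set.image_univ, b.span_eq]
    · obtain ⟨i, hi⟩ := hb2 W (Set.mem_insert_of_mem _ hW)
      have hi0 : i ≠ 0 := by
        rintro rfl
        exact (ha'.1 W hW).2 (by simpa [b.span_eq] using hi)
      have hiN : i < finrank K V := by
        by_contra hcon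
        refine (ha'.1 W hW).1 ?_
        rw [hi, show {j : Fin (finrank K V) | i ≤ (j : ℕ)} = ∅ from
          Set.eq_empty_of_forall_notMem fun j hj => by
            have hj' : i ≤ (j : ℕ) := hj
            omega, Set.image_empty, Submodule.span_empty]
      refine Finset.mem_image.2 ⟨finrank K V - i, Finset.mem_Ioo.2 ⟨by omega, by omega⟩, ?_⟩
      rw [reindex_rev_image b (Nat.sub_le _ _), hi, Nat.sub_sub_self hiN.le]

end Opposition

end ConeRadius

/-! ### The class `C_A` and opposition complexes -/

namespace ConeRadius

section ConeFunctions

open Module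

variable {K : Type u} {V : Type v} [DivisionRing K] [AddCommGroup V] [Module K V]

theorem sum_weight_le (n : ℕ) (F : Finset (Submodule K V)) :
    ∑ W ∈ F, weight n (finrank K W) ≤ ∑ j ∈ Finset.Icc 1 (n + 1),
      n.choose (j - 1) *
        Set.ncard {W : Submodule K V | W ∈ (F : Set (Submodule K V)) ∧ finrank K W = j} := by
  classical
  have hcard : ∀ j,
      Set.ncard {W : Submodule K V | W ∈ (F : Set (Submodule K V)) ∧ finrank K W = j} =
      (F.filter fun W : Submodule K V => finrank K W = j).card := fun j => by
    rw [← Set.ncard_coe_finset, Finset.coe_filter]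
    rfl
  simp only [hcard, Finset.card_filter, Finset.mul_sum]
  rw [Finset.sum_comm]
  refine Finset.sum_le_sum fun W _ => ?_
  simp only [mul_ite, mul_one, mul_zero, Finset.sum_ite_eq, Finset.mem_Icc]
  split_ifs with h
  · obtain ⟨d, hd⟩ := Nat.exists_eq_succ_of_ne_zero (by omega : finrank K W ≠ 0)
    rw [hd]
    exact le_rfl
  · by_cases h0 : finrank K W = 0
    · rw [h0, weight]
    · rw [weight_eq_zero_of_lt (by omega)]

theorem InClassA.exists_coneFunction {n : ℕ} {E : Set (Submodule K V)} (h : InClassA n E) :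
    ∃ C : ConeFunction (transversalComplex E) n,
      ∀ (p : ℕ) (hp : p ≤ n), C.radius p hp ≤ (intervalBound (n + 2) : ℕ∞) := by
  classical
  have hfin : FiniteDimensional K V :=
    FiniteDimensional.of_finrank_pos (by rw [h.finrank_eq]; omega)
  let F := h.finite.toFinset
  have hF : (F : Set (Submodule K V)) = E := h.finite.coe_toFinset
  have hS : {U : Submodule K V | (U ≠ ⊥ ∧ U ≠ ⊤) ∧ ∀ W ∈ E, Transversal U W} =
      transversalInterval ⊥ ⊤ F.toList := by
    ext U
    simp only [transversalInterval, RelTransversal, Transversal, bot_lt_iff_ne_bot,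
      lt_top_iff_ne_top, le_bot_iff, top_le_iff, Finset.mem_toList, F, Set.Finite.mem_toFinset]
  have hcone : HasCone {U : Submodule K V | (U ≠ ⊥ ∧ U ≠ ⊤) ∧ ∀ W ∈ E, Transversal U W} (n + 1)
      (intervalBound (n + 2)) := by
    rw [hS]
    refine hasCone_transversalInterval (n + 2) ⊥ ⊤ F.toList (n + 1) (by omega) bot_le ?_
      (fun W _ => ⟨bot_le, le_top⟩) fun n' hn' => ?_
    · rw [finrank_top, finrank_bot, h.finrank_eq, zero_add]
    · obtain rfl : n = n' := by omega
      refine le_trans ?_ h.sum_le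
      rw [Nat.cast_le, ← hF, familyWeight, finrank_bot]
      simp only [Nat.sub_zero]
      rw [Finset.sum_map_toList]
      exact sum_weight_le n F
  exact hcone.exists_coneFunction

theorem inClassA_of_mem_simplices {n : ℕ} (hn : 1 ≤ n) (hV : finrank K V = n + 1)
    (hK : ((2 ^ (n - 1) : ℕ) : ℕ∞) ≤ ENat.card K) {a : Finset (Submodule K V)}
    (ha : a ∈ simplices (building K V)) : InClassA (n - 1) (a : Set (Submodule K V)) := by
  have hfin : FiniteDimensional K V := FiniteDimensional.of_finrank_pos (by omega)
  refine ⟨by omega, a.finite_toSet, le_trans ?_ hK⟩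
  rw [Nat.cast_le, Nat.sub_add_cancel hn, ← Nat.sum_range_choose, Nat.sub_add_cancel hn]
  -- A flag has at most one member in each dimension.
  have hle : ∀ j,
      Set.ncard {W : Submodule K V | W ∈ (a : Set (Submodule K V)) ∧ finrank K W = j} ≤ 1 := by
    intro j
    rw [Set.ncard_le_one (a.finite_toSet.subset (Set.sep_subset _ _))]
    rintro U ⟨hU, rfl⟩ W ⟨hW, hUW⟩
    rcases ha with rfl | ⟨-, -, h⟩
    · simp at hU
    · rcases h U hU W hW with h | h
      · exact Submodule.eq_of_le_of_finrank_eq h hUW.symm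
      · exact (Submodule.eq_of_le_of_finrank_eq h hUW).symm
  rw [Finset.range_eq_Ico, Finset.sum_Ico_eq_sum_range, ← Finset.Ico_add_one_right_eq_Icc,
    Finset.sum_Ico_eq_sum_range]
  refine le_of_le_of_eq (Finset.sum_le_sum fun i _ => Nat.mul_le_mul_left _ (hle (1 + i))) ?_
  simp

end ConeFunctions

end ConeRadius

theorem mainTheorem7 :
    ∃ R : ℕ → ℕ,
      (∀ (n : ℕ) (K : Type u) [DivisionRing K] (V : Type v) [AddCommGroup V] [Module K V]
        (E : Set (Submodule K V)), ConeRadius.InClassA n E →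
          ∃ C : ConeRadius.ConeFunction (ConeRadius.transversalComplex E) n,
            ∀ (p : ℕ) (hp : p ≤ n), C.radius p hp ≤ (R n : ℕ∞)) ∧
      (∀ (n : ℕ), 1 ≤ n →
        ∀ (K : Type u) [DivisionRing K] (V : Type v) [AddCommGroup V] [Module K V],
          Module.finrank K V = n + 1 → ((2 ^ (n - 1) : ℕ) : ℕ∞) ≤ ENat.card K →
          ∀ a ∈ ConeRadius.simplices (ConeRadius.building K V),
            ∃ C : ConeRadius.ConeFunction (ConeRadius.oppositionComplex a) (n - 1),
              ∀ (p : ℕ) (hp : p ≤ n - 1), C.radius p hp ≤ (R (n - 1) : ℕ∞)) := by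
  refine ⟨fun n => ConeRadius.intervalBound (n + 2), fun n K _ V _ _ E hE =>
    hE.exists_coneFunction, fun n hn K _ V _ _ hV hK a ha => ?_⟩
  have hfin : FiniteDimensional K V := FiniteDimensional.of_finrank_pos (by omega)
  rw [ConeRadius.oppositionComplex_eq ha]
  exact (ConeRadius.inClassA_of_mem_simplices hn hV hK ha).exists_coneFunction
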